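/- **Setting.** Let $I\subseteq\mathbb R$ be a nonempty open set (for instance an interval) and let $P\in C^3(I)$ be a solution of the generalised Chazy equation with parameter $k=\tfrac32$, $$P'''-2PP''+3P'^2-\frac{4}{36-k^2}\,(6P'-P^2)^2=0,\qquad k=\tfrac32 .$$ Put $Q=P^2-6P'$ and $R=PQ-\tfrac32Q'$. Let $\int P$ be any primitive of $P$ on $I$, and put $E=\exp(\tfrac13\int P)$ and $H''=\exp(\tfrac23\int P)=E^2$. Let $\rho\in C^2(I)$ be nowhere zero with $\rho''-\tfrac1{45}Q\rho=0$, let $\xi=\rho'/\rho$, and let $\chi=\int\rho^{-2}\,dx$ be any primitive of $\rho^{-2}$ on $I$. On $U=\{(x,y,z,p,q)\in\mathbb R^5: x\in I\}$ let $\mathcal D$ be the distribution annihilated by $$dy-p\,dx,\qquad dp-q\,dx,\qquad dz-\frac{q^2}{H''(x)}\,dx .$$ **Vector fields.** Put $$B=9y\xi^2+2(Py-3p)\xi-\Big(\frac Q{60}-\frac{P^2}{12}\Big)y-Pp+\frac32q,\qquad G=3y\xi+\frac P3y-p,\qquad J=\frac{2\rho}{3E}B,$$ $$T=48y\xi^3+48\Big(\frac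 P3y-p\Big)\xi^2-16\Big(\frac{Q-5P^2}{60}y+pP-\frac32q\Big)\xi-\frac43\Big(\frac2{45}(PQ+R)y+\Big(P^2+\frac Q{15}\Big)p-6Pq\Big),$$ $$c_1=\frac{\chi^2}8J+\frac{\chi}{8\rho E}G-\frac{3}{8\rho^3E}y,\qquad c_3=-\frac\chi2J-\frac1{\rho E}G,$$ $$c_2=6z+6\chi J^2+\frac{16}{\rho E}JG+\frac1{E^2}\Big(-4(6\xi+P)p^2+2\Big(36\xi^2+8P\xi-\frac Q{15}+\frac{P^2}3\Big)yp-\Big(72\xi^3+24P\xi^2+\frac83P^2\xi+\frac19\Big(P^3+\frac15PQ+\frac25R\Big)\Big)y^2\Big),$$ $$\ell_3=\frac{\rho E}6\Big(\Big(36\xi^2+12P\xi+P^2+\frac Q{15}\Big)\rho^2\chi-4P-24\xi\Big)c_3^2+\frac{E}{4\rho}c_2+\rho^2T\,c_1,$$ $$X^1=\partial_q,\qquad X^2=\partial_x+p\,\partial_y+q\,\partial_p+\frac{q^2}{E^2}\,\partial_z,$$ $$\begin{aligned}X^3={}&\frac{4\rho^3\chi}{E}\Big(3y\xi^3+3\Big(\frac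 P3y-p\Big)\xi^2-\Big(\Big(\frac Q{60}-\frac{P^2}{12}\Big)y+Pp\Big)\xi-\frac{PQ+R}{270}y-\frac1{12}\Big(P^2+\frac Q{15}\Big)p\Big)\partial_z-\rho^3\chi E\Big(\partial_y+\frac13(P+9\xi)\partial_p\Big)\\&+\frac{4\rho}{E}\Big(3y\xi^2+2\Big(\frac P3y-p\Big)\xi-\frac13\Big(\Big(\frac Q{60}-\frac{P^2}{12}\Big)y+pP-3q\Big)\Big)\partial_z+\rho E\,\partial_p,\end{aligned}$$ $$S^1=-\rho^2T\,X^1-8\rho^2X^2,\qquad S^2=\frac{E}{4\rho}X^1,$$ $$S^3=\ell_3X^1+\frac{2}{3\rho E}\Big(\rho^4\chi^2B+\frac32\rho^2\chi G-\frac92y\Big)X^2-\frac{1}{9\rho^2E^2}\big(\rho^2\chi B+9y\xi+Py-3p\big)^2X^3 .$$ **Theorem.** (a) At every point of $U$, $\mathcal D$ is spanned by $X^1,X^2$, and also by $S^1,S^2$. (b) $\mathcal D$ is maximally symmetric, in the sense that around every point of $U$ there is a smooth local diffeomorphism onto an open subset of $\mathbb R^5$, with coordinates $(a_1,\dots,a_5)$,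 carrying $\mathcal D$ to the flat Cartan distribution, which is annihilated by $$da_1+(a_3+\tfrac12a_4a_5)\,da_4,\qquad da_2+(a_3-\tfrac12a_4a_5)\,da_5,\qquad da_3+\tfrac12a_4\,da_5-\tfrac12a_5\,da_4 .$$ (c) $S^1,S^2,S^3$ are smooth on $U$ and pairwise bracket-generate the Lie algebra of split $\mathfrak g_2$. This means the following. Put $S^4=[S^1,S^2]$, $S^5=[S^2,S^3]$, $S^6=[S^3,S^1]$, $L^1=[S^1,S^4]$, $L^2=[S^2,S^4]$, $L^3=[S^2,S^5]$, $L^4=[S^3,S^5]$, $L^5=[S^3,S^6]$, $L^6=[S^1,S^6]$, $H=[S^2,S^6]$, $h=[S^4,S^3]$ (this vector field $H$ is not the function with second derivative $H''$ above), $h^1=\tfrac14(h-H)$, $h^2=\tfrac{\sqrt3}{12}(h+H)$. Then: - the fourteen vector fields $S^1,\dots,S^6,h^1,h^2,L^1,\dots,L^6$ are linearly independent over $\mathbb R$, and their real span is the Lie algebra generated by $S^1,S^2,S^3$ in the Lie algebra of smooth vector fields on $U$; - this 14-dimensional real Lie algebra is isomorphic to the split real form of $\mathfrak g_2$; - $h^1,h^2$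 span a Cartan subalgebra of it; - the other twelve fields are root vectors: $[h^1,V]=\alpha_1V$ and $[h^2,V]=\alpha_2V$, where for $V=S^1,\dots,S^6$ the pair $(\alpha_1,\alpha_2)$ is $$(1,0),\ (-\tfrac12,\tfrac{\sqrt3}2),\ (-\tfrac12,-\tfrac{\sqrt3}2),\ (\tfrac12,\tfrac{\sqrt3}2),\ (-1,0),\ (\tfrac12,-\tfrac{\sqrt3}2),$$ and for $V=L^1,\dots,L^6$ it is $$(\tfrac32,\tfrac{\sqrt3}2),\ (0,\sqrt3),\ (-\tfrac32,\tfrac{\sqrt3}2),\ (-\tfrac32,-\tfrac{\sqrt3}2),\ (0,-\sqrt3),\ (\tfrac32,-\tfrac{\sqrt3}2).$$ -/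

import Mathlib

open Set TopologicalSpace
open scoped ContDiff

noncomputable section

/-! ### The Lie algebra of smooth vector fields on an open set -/

section SmoothFields

variable {E : Type*} [NormedAddCommGroup E] [NormedSpace ℝ E]

/-- The real vector space `𝔛(U)` of smooth vector fields on the open set `U`. A field on `U` is
represented by its extension by zero, so that two elements are equal iff they agree on `U`. -/
def SmoothField (U : Opens E) : Submodule ℝ (E → E) where
  carrier := {V | ContDiffOn ℝ ∞ V U ∧ ∀ x ∉ U, V x = 0}
  add_mem' := by
    rintro V W ⟨hV, hV'⟩ ⟨hW, hW'⟩
    exact ⟨hV.add hW, fun x hx => by simp [hV' x hx, hW' x hx]⟩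
  zero_mem' := ⟨contDiffOn_const, fun _ _ => rfl⟩
  smul_mem' := by
    rintro c V ⟨hV, hV'⟩
    exact ⟨hV.const_smul c, fun x hx => by simp [hV' x hx]⟩

namespace SmoothField

variable {U : Opens E}

/-- The smooth vector field on `U` given by a function that is smooth on `U`. -/
def ofContDiffOn (V : E → E) (hV : ContDiffOn ℝ ∞ V U) : SmoothField U :=
  ⟨(U : Set E).indicator V,
    hV.congr fun _ hx => indicator_of_mem hx V, fun _ hx => indicator_of_notMem hx V⟩

theorem contDiffAt (V : SmoothField U) {x : E} (hx : x ∈ U) : ContDiffAt ℝ ∞ V.1 x :=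
  V.2.1.contDiffAt (U.isOpen.mem_nhds hx)

theorem differentiableAt (V : SmoothField U) {x : E} (hx : x ∈ U) : DifferentiableAt ℝ V.1 x :=
  (contDiffAt V hx).differentiableAt (by simp)

/-- The usual Lie bracket `[V, W] = DW · V - DV · W` of vector fields. -/
instance : Bracket (SmoothField U) (SmoothField U) where
  bracket V W := ⟨VectorField.lieBracket ℝ V.1 W.1,
    fun _ hx => (ContDiffAt.lieBracket_vectorField (n := ∞) (contDiffAt V hx) (contDiffAt W hx)
      (by simp)).contDiffWithinAt,
    fun x hx => VectorField.lieBracket_eq_zero_of_eq_zero (V.2.2 x hx) (W.2.2 x hx)⟩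

theorem coe_bracket (V W : SmoothField U) :
    (⁅V, W⁆ : SmoothField U).1 = VectorField.lieBracket ℝ V.1 W.1 := rfl

theorem ext_on {V W : SmoothField U} (h : ∀ x ∈ U, V.1 x = W.1 x) : V = W := by
  refine Subtype.ext (funext fun x => ?_)
  by_cases hx : x ∈ U
  · exact h x hx
  · rw [V.2.2 x hx, W.2.2 x hx]

instance : LieRing (SmoothField U) where
  add_lie V V' W := ext_on fun x hx =>
    VectorField.lieBracket_add_left (differentiableAt V hx) (differentiableAt V' hx)
  lie_add V W W' := ext_on fun x hx =>
    VectorField.lieBracket_add_right (differentiableAt W hx) (differentiableAt W' hx)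
  lie_self V := Subtype.ext (VectorField.lieBracket_self (𝕜 := ℝ))
  leibniz_lie V W X := ext_on fun x hx =>
    VectorField.leibniz_identity_lieBracket (n := ∞)
      (by simpa using (by exact_mod_cast le_top : ((2 : ℕ∞) : WithTop ℕ∞) ≤ ((⊤ : ℕ∞) : WithTop ℕ∞)))
      (contDiffAt V hx) (contDiffAt W hx) (contDiffAt X hx)

instance : LieAlgebra ℝ (SmoothField U) where
  lie_smul _ _ W := ext_on fun _ hx =>
    VectorField.lieBracket_const_smul_right (differentiableAt W hx)

end SmoothField

end SmoothFields

/-! ### Pairwise bracket-generating triples for split `𝔤₂` -/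

namespace BracketG2

section

variable {𝔏 : Type*} [LieRing 𝔏] [LieAlgebra ℝ 𝔏]

/-- The twelve elements `S¹, …, S⁶, L¹, …, L⁶` obtained from `S¹, S², S³`, where
`S⁴ = [S¹,S²]`, `S⁵ = [S²,S³]`, `S⁶ = [S³,S¹]`, `L¹ = [S¹,S⁴]`, `L² = [S²,S⁴]`, `L³ = [S²,S⁵]`,
`L⁴ = [S³,S⁵]`, `L⁵ = [S³,S⁶]`, `L⁶ = [S¹,S⁶]`. -/
def rootVector (S₁ S₂ S₃ : 𝔏) : Fin 12 → 𝔏 :=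
  ![S₁, S₂, S₃, ⁅S₁, S₂⁆, ⁅S₂, S₃⁆, ⁅S₃, S₁⁆,
    ⁅S₁, ⁅S₁, S₂⁆⁆, ⁅S₂, ⁅S₁, S₂⁆⁆, ⁅S₂, ⁅S₂, S₃⁆⁆,
    ⁅S₃, ⁅S₂, S₃⁆⁆, ⁅S₃, ⁅S₃, S₁⁆⁆, ⁅S₁, ⁅S₃, S₁⁆⁆]

/-- The pair `h¹ = (h - H) / 4`, `h² = (√3 / 12) (h + H)`, where `h = [S⁴,S³]`, `H = [S²,S⁶]`. -/
def cartanVector (S₁ S₂ S₃ : 𝔏) : Fin 2 → 𝔏 :=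
  ![(1 / 4 : ℝ) • (⁅⁅S₁, S₂⁆, S₃⁆ - ⁅S₂, ⁅S₃, S₁⁆⁆),
    (√3 / 12 : ℝ) • (⁅⁅S₁, S₂⁆, S₃⁆ + ⁅S₂, ⁅S₃, S₁⁆⁆)]

/-- The root diagram: the positions in the plane of `S¹, …, S⁶, L¹, …, L⁶`, in this order. -/
def rootPosition : Fin 12 → ℝ × ℝ :=
  ![(1, 0), (-1 / 2, √3 / 2), (-1 / 2, -√3 / 2), (1 / 2, √3 / 2), (-1, 0), (1 / 2, -√3 / 2),
    (3 / 2, √3 / 2), (0, √3), (-3 / 2, √3 / 2), (-3 / 2, -√3 / 2), (0, -√3), (3 / 2, -√3 / 2)]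

/-- `S₁, S₂, S₃` pairwise bracket-generate the Lie algebra of split `𝔤₂`. -/
structure PairwiseGenerates (S₁ S₂ S₃ : 𝔏) : Prop where
  /-- The fourteen elements are linearly independent. -/
  linearIndependent :
    LinearIndependent ℝ (Sum.elim (rootVector S₁ S₂ S₃) (cartanVector S₁ S₂ S₃))
  /-- They span the Lie algebra generated by `S₁, S₂, S₃`. -/
  span_eq :
    Submodule.span ℝ (range (Sum.elim (rootVector S₁ S₂ S₃) (cartanVector S₁ S₂ S₃))) =
      (LieSubalgebra.lieSpan ℝ 𝔏 {S₁, S₂, S₃}).toSubmodule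
  /-- This Lie algebra is the split real form of `𝔤₂`. -/
  equiv_g₂ : Nonempty (LieSubalgebra.lieSpan ℝ 𝔏 {S₁, S₂, S₃} ≃ₗ⁅ℝ⁆ LieAlgebra.g₂ ℝ)
  /-- The elements `h¹, h²` span a Cartan subalgebra of it. -/
  cartan : ∃ 𝔥 : LieSubalgebra ℝ (LieSubalgebra.lieSpan ℝ 𝔏 {S₁, S₂, S₃}),
    𝔥.IsCartanSubalgebra ∧
      𝔥.toSubmodule.map (LieSubalgebra.lieSpan ℝ 𝔏 {S₁, S₂, S₃}).toSubmodule.subtype =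
        Submodule.span ℝ (range (cartanVector S₁ S₂ S₃))
  /-- With respect to `h¹, h²` the other twelve elements are root vectors, with the roots of the
  root diagram. -/
  root : ∀ i,
    ⁅cartanVector S₁ S₂ S₃ 0, rootVector S₁ S₂ S₃ i⁆ =
        (rootPosition i).1 • rootVector S₁ S₂ S₃ i ∧
      ⁅cartanVector S₁ S₂ S₃ 1, rootVector S₁ S₂ S₃ i⁆ =
        (rootPosition i).2 • rootVector S₁ S₂ S₃ i

end

end BracketG2

/-! ### Rank 2 distributions on five-dimensional space -/

namespace Distribution235

/-- The `i`-th coordinate 1-form on `ℝ⁵`. -/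
def coordForm (i : Fin 5) : (Fin 5 → ℝ) →ₗ[ℝ] ℝ := LinearMap.proj i

/-- The distribution on the space with coordinates `(x, y, z, p, q) = (m 0, m 1, m 2, m 3, m 4)`
annihilated by `dy - p dx`, `dp - q dx` and `dz - (q² / H''(x)) dx`, where `H₂` stands for `H''`. -/
def monge (H₂ : ℝ → ℝ) (m : Fin 5 → ℝ) : Submodule ℝ (Fin 5 → ℝ) :=
  LinearMap.ker (coordForm 1 - m 3 • coordForm 0) ⊓
  LinearMap.ker (coordForm 3 - m 4 • coordForm 0) ⊓
  LinearMap.ker (coordForm 2 - ((m 4) ^ 2 / H₂ (m 0)) • coordForm 0)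

/-- The flat Cartan distribution on the space with coordinates
`(a₁, a₂, a₃, a₄, a₅) = (a 0, a 1, a 2, a 3, a 4)`, annihilated by `da₁ + (a₃ + a₄a₅/2) da₄`,
`da₂ + (a₃ - a₄a₅/2) da₅` and `da₃ + (a₄/2) da₅ - (a₅/2) da₄`. -/
def flatCartan (a : Fin 5 → ℝ) : Submodule ℝ (Fin 5 → ℝ) :=
  LinearMap.ker (coordForm 0 + (a 2 + 1 / 2 * a 3 * a 4) • coordForm 3) ⊓
  LinearMap.ker (coordForm 1 + (a 2 - 1 / 2 * a 3 * a 4) • coordForm 4) ⊓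
  LinearMap.ker (coordForm 2 + (1 / 2 * a 3) • coordForm 4 - (1 / 2 * a 4) • coordForm 3)

/-- Around every point of `U` there is a smooth local diffeomorphism that carries the distribution
`D` to the flat Cartan distribution. -/
def IsLocallyFlatOn (D : (Fin 5 → ℝ) → Submodule ℝ (Fin 5 → ℝ)) (U : Opens (Fin 5 → ℝ)) : Prop :=
  ∀ m ∈ U, ∃ e : OpenPartialHomeomorph (Fin 5 → ℝ) (Fin 5 → ℝ),
    m ∈ e.source ∧ e.source ⊆ U ∧
    ContDiffOn ℝ ∞ e e.source ∧ ContDiffOn ℝ ∞ e.symm e.target ∧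
    ∀ m' ∈ e.source, (D m').map (fderiv ℝ e m').toLinearMap = flatCartan (e m')

end Distribution235

/-! ### The generalised Chazy equation and the vector fields -/

namespace Chazy

/-- `y` is a solution on the open set `I` of the generalised Chazy equation with parameter `k`
(`k ≠ ±6`). -/
def IsSolution (k : ℝ) (y : ℝ → ℝ) (I : Opens ℝ) : Prop :=
  ContDiffOn ℝ 3 y I ∧ ∀ x ∈ I,
    iteratedDeriv 3 y x - 2 * y x * iteratedDeriv 2 y x + 3 * (deriv y x) ^ 2
      - 4 / (36 - k ^ 2) * (6 * deriv y x - (y x) ^ 2) ^ 2 = 0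

/-- `Q = P² - 6P'`, that is, `P' = (P² - Q) / 6`. -/
def Q (P : ℝ → ℝ) (x : ℝ) : ℝ := (P x) ^ 2 - 6 * deriv P x

/-- `R = PQ - (3/2) Q'`, that is, `Q' = (2/3) (PQ - R)`. -/
def R (P : ℝ → ℝ) (x : ℝ) : ℝ := P x * Q P x - 3 / 2 * deriv (Q P) x

/-- `ξ = ρ' / ρ`. -/
def ξ (ρ : ℝ → ℝ) (x : ℝ) : ℝ := deriv ρ x / ρ x

/-- The open set of the points `(x, y, z, p, q)` with `x ∈ I`. -/
def domain (I : Opens ℝ) : Opens (Fin 5 → ℝ) :=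
  ⟨{m | m 0 ∈ I}, I.isOpen.preimage (continuous_apply 0)⟩

/-- The vector field `X¹ = ∂_q`. -/
def X₁ : (Fin 5 → ℝ) → (Fin 5 → ℝ) := fun _ => ![0, 0, 0, 0, 1]

section

/- `F` is a primitive of `P`, and `χ` is a primitive of `1 / ρ²`. Points are
`m = (x, y, z, p, q)`, and components of vector fields are in the order
`∂_x, ∂_y, ∂_z, ∂_p, ∂_q`. -/
variable (P F ρ χ : ℝ → ℝ) (m : Fin 5 → ℝ)

/-- The vector field `X² = ∂_x + p ∂_y + q ∂_p + q² e^{-(2/3)∫P} ∂_z`. -/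
def X₂ : Fin 5 → ℝ :=
  ![1, m 3, (m 4) ^ 2 * Real.exp (-(2 / 3) * F (m 0)), m 4, 0]

/-- The vector field `X³`. -/
def X₃ : Fin 5 → ℝ :=
  let x := m 0
  let y := m 1
  let p := m 3
  let q := m 4
  ![0,
    -((ρ x) ^ 3 * χ x * Real.exp (1 / 3 * F x)),
    4 * (ρ x) ^ 3 * χ x * Real.exp (-(1 / 3) * F x) *
        (3 * y * (ξ ρ x) ^ 3 + 3 * (P x / 3 * y - p) * (ξ ρ x) ^ 2
          - ((Q P x / 60 - (P x) ^ 2 / 12) * y + P x * p) * ξ ρ x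
          - 1 / 270 * (P x * Q P x + R P x) * y - 1 / 12 * ((P x) ^ 2 + Q P x / 15) * p)
      + 4 * ρ x * Real.exp (-(1 / 3) * F x) *
        (3 * y * (ξ ρ x) ^ 2 + 2 * (P x / 3 * y - p) * ξ ρ x
          - 1 / 3 * ((Q P x / 60 - (P x) ^ 2 / 12) * y + p * P x - 3 * q)),
    -((ρ x) ^ 3 * χ x * Real.exp (1 / 3 * F x)) * (1 / 3 * (P x + 9 * ξ ρ x))
      + ρ x * Real.exp (1 / 3 * F x),
    0]

/-- `9yξ² + 2(Py - 3p)ξ - (Q/60 - P²/12)y - Pp + (3/2)q`. -/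
def B : ℝ :=
  9 * m 1 * (ξ ρ (m 0)) ^ 2 + 2 * (P (m 0) * m 1 - 3 * m 3) * ξ ρ (m 0)
    - (Q P (m 0) / 60 - (P (m 0)) ^ 2 / 12) * m 1 - P (m 0) * m 3 + 3 / 2 * m 4

/-- `J = (2/3) ρ e^{-(1/3)∫P} (9yξ² + 2(Py - 3p)ξ - (Q/60 - P²/12)y - Pp + (3/2)q)`. -/
def J : ℝ := 2 / 3 * ρ (m 0) * Real.exp (-(1 / 3) * F (m 0)) * B P ρ m

/-- `3yξ + (P/3)y - p`. -/
def G : ℝ := 3 * m 1 * ξ ρ (m 0) + P (m 0) / 3 * m 1 - m 3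

/-- The function `c₁`. -/
def c₁ : ℝ :=
  (χ (m 0)) ^ 2 / 8 * J P F ρ m
    + χ (m 0) / (8 * ρ (m 0)) * Real.exp (-(1 / 3) * F (m 0)) * G P ρ m
    - 3 / (8 * (ρ (m 0)) ^ 3) * Real.exp (-(1 / 3) * F (m 0)) * m 1

/-- The function `c₂`. -/
def c₂ : ℝ :=
  let x := m 0
  let y := m 1
  let p := m 3
  6 * m 2 + 6 * χ x * (J P F ρ m) ^ 2
    + 16 / ρ x * J P F ρ m * Real.exp (-(1 / 3) * F x) * G P ρ m
    + Real.exp (-(2 / 3) * F x) *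
      (-4 * (6 * ξ ρ x + P x) * p ^ 2
        + 2 * (36 * (ξ ρ x) ^ 2 + 8 * P x * ξ ρ x - 1 / 15 * Q P x + 1 / 3 * (P x) ^ 2) * y * p
        - (72 * (ξ ρ x) ^ 3 + 24 * P x * (ξ ρ x) ^ 2 + 8 / 3 * (P x) ^ 2 * ξ ρ x
            + 1 / 9 * ((P x) ^ 3 + 1 / 5 * P x * Q P x + 2 / 5 * R P x)) * y ^ 2)

/-- The function `c₃`. -/
def c₃ : ℝ :=
  -(χ (m 0) / 2) * J P F ρ m - 1 / ρ (m 0) * Real.exp (-(1 / 3) * F (m 0)) * G P ρ m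

/-- `48yξ³ + 48((P/3)y - p)ξ² - 16(((Q - 5P²)/60)y + pP - (3/2)q)ξ
- (4/3)((2/45)(PQ + R)y + (P² + Q/15)p - 6Pq)`. -/
def T : ℝ :=
  let x := m 0
  let y := m 1
  let p := m 3
  let q := m 4
  48 * y * (ξ ρ x) ^ 3 + 48 * (P x / 3 * y - p) * (ξ ρ x) ^ 2
    - 16 * ((Q P x - 5 * (P x) ^ 2) / 60 * y + p * P x - 3 / 2 * q) * ξ ρ x
    - 4 / 3 * (2 / 45 * (P x * Q P x + R P x) * y + ((P x) ^ 2 + Q P x / 15) * p - 6 * P x * q)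

/-- The function `ℓ₃`. -/
def ell₃ : ℝ :=
  let x := m 0
  ρ x * Real.exp (1 / 3 * F x) / 6 *
      ((36 * (ξ ρ x) ^ 2 + 12 * P x * ξ ρ x + (P x) ^ 2 + Q P x / 15) * (ρ x) ^ 2 * χ x
        - 4 * P x - 24 * ξ ρ x) * (c₃ P F ρ χ m) ^ 2
    + Real.exp (1 / 3 * F x) / (4 * ρ x) * c₂ P F ρ χ m
    + (ρ x) ^ 2 * T P ρ m * c₁ P F ρ χ m

/-- The vector field `S¹`. -/
def S₁ : Fin 5 → ℝ :=
  -((ρ (m 0)) ^ 2 * T P ρ m) • X₁ m - (8 * (ρ (m 0)) ^ 2) • X₂ F m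

/-- The vector field `S²`. -/
def S₂ : Fin 5 → ℝ := (Real.exp (1 / 3 * F (m 0)) / (4 * ρ (m 0))) • X₁ m

/-- The vector field `S³`. -/
def S₃ : Fin 5 → ℝ :=
  let x := m 0
  let y := m 1
  let p := m 3
  ell₃ P F ρ χ m • X₁ m
    + (2 * Real.exp (-(1 / 3) * F x) / (3 * ρ x) *
        ((ρ x) ^ 4 * (χ x) ^ 2 * B P ρ m + 3 / 2 * (ρ x) ^ 2 * χ x * G P ρ m - 9 / 2 * y)) •
      X₂ F m
    - (Real.exp (-(2 / 3) * F x) / (9 * (ρ x) ^ 2) *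
        ((ρ x) ^ 2 * χ x * B P ρ m + 9 * y * ξ ρ x + P x * y - 3 * p) ^ 2) • X₃ P F ρ χ m

end

end Chazy

end

/-! ### Lie algebras with a system of Chevalley generators of type `G₂` -/

section SerreSystem

variable {𝔏 : Type*} [LieRing 𝔏] [LieAlgebra ℝ 𝔏]

/-! The distribution is the Hilbert–Cartan equation in disguise. Put w = y/(ρ³E) and take χ as
independent variable. Along curves tangent to 𝒟 on which x is a parameter, w_χ = -G/(ρE) and w_χχ =
J. Moreover, with `K` the quadratic form in (y, p) occurring in c₂, the function Z = z + K/(6E²)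
satisfies Z_χ = J². This last identity says that J² dχ - (q²/E²) dx is the differential of K/(6E²)
along 𝒟, and it is here that the Chazy equation is needed. Thus 𝒟 becomes Z' = (w'')².

The map `flatMap` records this in flat coordinates: a₁ = -w, a₂ = Z/2 + χJ²/2 - w_χ J, a₃ = w_χ -
χJ/2, a₄ = χ, a₅ = J. Its differential is triangular, hence invertible (`eq_zero_of_dFlatMap`). It
sends S¹ and S² to polynomial fields `e₁` and `e₁₂` = [e₁, e₂] that span the flat Cartan
distribution (`dFlatMap_S₁`, `dFlatMap_S₂`), which gives (b).

For (c), S³ = -c₁S¹ + c₂S² + c₃²Y, where the c's are polynomials in the flat coordinates and Y goes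
to (-a₄, -a₅, -1, 0, 0). So S³ goes to half of `f₁₁₂` = [f₁, [f₁, f₂]] (`S₃_eq`, `evalField_f₁₁₂`).
Pullback along a local diffeomorphism is a Lie homomorphism, and it is injective on polynomial
fields because a polynomial vanishing on an open set is zero. Everything is thereby reduced to the
triple e₁, [e₁, e₂], ½[f₁, [f₁, f₂]] in a Lie algebra containing Chevalley generators of type G₂.

That algebraic part works in any Lie algebra. The triple consists of root vectors for three short
roots with sum zero, and its brackets reach all twelve root vectors up to nonzero scalars, and the
Cartan elements. The Serre relations alone bound the dimension of the generated algebra by 14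
(`lieSpan_le_span_chevalleyBasis`). Hence linear independence of the 14 candidate elements
identifies it with 𝔤₂, presented as a free Lie algebra modulo the Serre relations
(`serreIdeal_eq_ker`). -/

theorem lie_eq_neg_one_smul (x y : 𝔏) : ⁅x, y⁆ = (-1 : ℝ) • ⁅y, x⁆ := by
  rw [← lie_skew]; module

/-- The elements `e₁, e₂, f₁, f₂, h₁, h₂` satisfy the Serre relations of type `G₂`, where the first
simple root is the short one. -/
structure IsSerreG₂ (e₁ e₂ f₁ f₂ h₁ h₂ : 𝔏) : Prop where
  h₁_h₂ : ⁅h₁, h₂⁆ = 0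
  e₁_f₁ : ⁅e₁, f₁⁆ = h₁
  e₂_f₂ : ⁅e₂, f₂⁆ = h₂
  e₁_f₂ : ⁅e₁, f₂⁆ = 0
  e₂_f₁ : ⁅e₂, f₁⁆ = 0
  h₁_e₁ : ⁅h₁, e₁⁆ = (2 : ℝ) • e₁
  h₁_e₂ : ⁅h₁, e₂⁆ = (-3 : ℝ) • e₂
  h₂_e₁ : ⁅h₂, e₁⁆ = (-1 : ℝ) • e₁
  h₂_e₂ : ⁅h₂, e₂⁆ = (2 : ℝ) • e₂
  h₁_f₁ : ⁅h₁, f₁⁆ = (-2 : ℝ) • f₁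
  h₁_f₂ : ⁅h₁, f₂⁆ = (3 : ℝ) • f₂
  h₂_f₁ : ⁅h₂, f₁⁆ = (1 : ℝ) • f₁
  h₂_f₂ : ⁅h₂, f₂⁆ = (-2 : ℝ) • f₂
  ad_e₁ : ⁅e₁, ⁅e₁, ⁅e₁, ⁅e₁, e₂⁆⁆⁆⁆ = 0
  ad_e₂ : ⁅e₂, ⁅e₂, e₁⁆⁆ = 0
  ad_f₁ : ⁅f₁, ⁅f₁, ⁅f₁, ⁅f₁, f₂⁆⁆⁆⁆ = 0
  ad_f₂ : ⁅f₂, ⁅f₂, f₁⁆⁆ = 0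

namespace IsSerreG₂

variable {e₁ e₂ f₁ f₂ h₁ h₂ : 𝔏} (s : IsSerreG₂ e₁ e₂ f₁ f₂ h₁ h₂)

include s

/-- The Chevalley involution. -/
theorem symm : IsSerreG₂ f₁ f₂ e₁ e₂ (-h₁) (-h₂) where
  h₁_h₂ := by simp [s.h₁_h₂]
  e₁_f₁ := by rw [← lie_skew, s.e₁_f₁]
  e₂_f₂ := by rw [← lie_skew, s.e₂_f₂]
  e₁_f₂ := by rw [← lie_skew, s.e₂_f₁, neg_zero]
  e₂_f₁ := by rw [← lie_skew, s.e₁_f₂, neg_zero]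
  h₁_e₁ := by rw [neg_lie, s.h₁_f₁]; module
  h₁_e₂ := by rw [neg_lie, s.h₁_f₂]; module
  h₂_e₁ := by rw [neg_lie, s.h₂_f₁]; module
  h₂_e₂ := by rw [neg_lie, s.h₂_f₂]; module
  h₁_f₁ := by rw [neg_lie, s.h₁_e₁]; module
  h₁_f₂ := by rw [neg_lie, s.h₁_e₂]; module
  h₂_f₁ := by rw [neg_lie, s.h₂_e₁]; module
  h₂_f₂ := by rw [neg_lie, s.h₂_e₂]; module
  ad_e₁ := s.ad_f₁
  ad_e₂ := s.ad_f₂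
  ad_f₁ := s.ad_e₁
  ad_f₂ := s.ad_e₂

theorem f₁_e₁ : ⁅f₁, e₁⁆ = (-1 : ℝ) • h₁ := by rw [← lie_skew, s.e₁_f₁]; module
theorem f₂_e₂ : ⁅f₂, e₂⁆ = (-1 : ℝ) • h₂ := by rw [← lie_skew, s.e₂_f₂]; module
theorem f₂_e₁ : ⁅f₂, e₁⁆ = 0 := by rw [← lie_skew, s.e₁_f₂, neg_zero]
theorem f₁_e₂ : ⁅f₁, e₂⁆ = 0 := by rw [← lie_skew, s.e₂_f₁, neg_zero]
theorem e₁_h₁ : ⁅e₁, h₁⁆ = (-2 : ℝ) • e₁ := by rw [← lie_skew, s.h₁_e₁]; module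
theorem e₁_h₂ : ⁅e₁, h₂⁆ = (1 : ℝ) • e₁ := by rw [← lie_skew, s.h₂_e₁]; module
theorem e₂_h₁ : ⁅e₂, h₁⁆ = (3 : ℝ) • e₂ := by rw [← lie_skew, s.h₁_e₂]; module
theorem e₂_h₂ : ⁅e₂, h₂⁆ = (-2 : ℝ) • e₂ := by rw [← lie_skew, s.h₂_e₂]; module

/-- Subscripts spell right-nested brackets: `e₂₁₁₁₂` stands for [e₂, [e₁, [e₁, [e₁, e₂]]]]. Weights
add over the letters of the word. -/
theorem h₁_e₁₂ : ⁅h₁, ⁅e₁, e₂⁆⁆ = (-1 : ℝ) • ⁅e₁, e₂⁆ := by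
  rw [leibniz_lie, s.h₁_e₁, s.h₁_e₂, smul_lie, lie_smul]; module
theorem h₂_e₁₂ : ⁅h₂, ⁅e₁, e₂⁆⁆ = (1 : ℝ) • ⁅e₁, e₂⁆ := by
  rw [leibniz_lie, s.h₂_e₁, s.h₂_e₂, smul_lie, lie_smul]; module
theorem h₁_e₁₁₂ : ⁅h₁, ⁅e₁, ⁅e₁, e₂⁆⁆⁆ = (1 : ℝ) • ⁅e₁, ⁅e₁, e₂⁆⁆ := by
  rw [leibniz_lie, s.h₁_e₁, s.h₁_e₁₂, smul_lie, lie_smul]; module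
theorem h₂_e₁₁₂ : ⁅h₂, ⁅e₁, ⁅e₁, e₂⁆⁆⁆ = (0 : ℝ) • ⁅e₁, ⁅e₁, e₂⁆⁆ := by
  rw [leibniz_lie, s.h₂_e₁, s.h₂_e₁₂, smul_lie, lie_smul]; module
theorem h₁_e₁₁₁₂ : ⁅h₁, ⁅e₁, ⁅e₁, ⁅e₁, e₂⁆⁆⁆⁆ = (3 : ℝ) • ⁅e₁, ⁅e₁, ⁅e₁, e₂⁆⁆⁆ := by
  rw [leibniz_lie, s.h₁_e₁, s.h₁_e₁₁₂, smul_lie, lie_smul]; module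
theorem h₂_e₁₁₁₂ : ⁅h₂, ⁅e₁, ⁅e₁, ⁅e₁, e₂⁆⁆⁆⁆ = (-1 : ℝ) • ⁅e₁, ⁅e₁, ⁅e₁, e₂⁆⁆⁆ := by
  rw [leibniz_lie, s.h₂_e₁, s.h₂_e₁₁₂, smul_lie, lie_smul]; module
theorem h₁_e₂₁₁₁₂ : ⁅h₁, ⁅e₂, ⁅e₁, ⁅e₁, ⁅e₁, e₂⁆⁆⁆⁆⁆ = (0 : ℝ) • ⁅e₂, ⁅e₁, ⁅e₁, ⁅e₁, e₂⁆⁆⁆⁆ := by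
  rw [leibniz_lie, s.h₁_e₂, s.h₁_e₁₁₁₂, smul_lie, lie_smul]; module
theorem h₂_e₂₁₁₁₂ : ⁅h₂, ⁅e₂, ⁅e₁, ⁅e₁, ⁅e₁, e₂⁆⁆⁆⁆⁆ = (1 : ℝ) • ⁅e₂, ⁅e₁, ⁅e₁, ⁅e₁, e₂⁆⁆⁆⁆ := by
  rw [leibniz_lie, s.h₂_e₂, s.h₂_e₁₁₁₂, smul_lie, lie_smul]; module

/-- The constants 3, 4, 3 are k(4 - k): f₁ lowers the four-dimensional 𝔰𝔩₂-string e₂, e₁₂, e₁₁₂,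
e₁₁₁₂, whose lowest weight for h₁ is -3. -/
theorem f₁_e₁₂ : ⁅f₁, ⁅e₁, e₂⁆⁆ = (3 : ℝ) • e₂ := by
  rw [leibniz_lie, s.f₁_e₁, s.f₁_e₂, smul_lie, s.h₁_e₂, lie_zero]; module
theorem f₂_e₁₂ : ⁅f₂, ⁅e₁, e₂⁆⁆ = (-1 : ℝ) • e₁ := by
  rw [leibniz_lie, s.f₂_e₁, s.f₂_e₂, lie_smul, s.e₁_h₂, zero_lie]; module
theorem f₁_e₁₁₂ : ⁅f₁, ⁅e₁, ⁅e₁, e₂⁆⁆⁆ = (4 : ℝ) • ⁅e₁, e₂⁆ := by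
  rw [leibniz_lie, s.f₁_e₁, s.f₁_e₁₂, smul_lie, s.h₁_e₁₂, lie_smul]; module
theorem f₂_e₁₁₂ : ⁅f₂, ⁅e₁, ⁅e₁, e₂⁆⁆⁆ = 0 := by
  rw [leibniz_lie, s.f₂_e₁, s.f₂_e₁₂, lie_smul, lie_self, zero_lie]; module
theorem f₁_e₁₁₁₂ : ⁅f₁, ⁅e₁, ⁅e₁, ⁅e₁, e₂⁆⁆⁆⁆ = (3 : ℝ) • ⁅e₁, ⁅e₁, e₂⁆⁆ := by
  rw [leibniz_lie, s.f₁_e₁, s.f₁_e₁₁₂, smul_lie, s.h₁_e₁₁₂, lie_smul]; module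
theorem f₂_e₁₁₁₂ : ⁅f₂, ⁅e₁, ⁅e₁, ⁅e₁, e₂⁆⁆⁆⁆ = 0 := by
  rw [leibniz_lie, s.f₂_e₁, s.f₂_e₁₁₂, lie_zero, zero_lie]; module

theorem e₂_e₁₂ : ⁅e₂, ⁅e₁, e₂⁆⁆ = 0 := by
  rw [← lie_skew e₁ e₂, lie_neg, s.ad_e₂, neg_zero]
theorem e₂_e₁₁₂ : ⁅e₂, ⁅e₁, ⁅e₁, e₂⁆⁆⁆ = 0 := by
  rw [leibniz_lie, lie_eq_neg_one_smul e₂ e₁, smul_lie, lie_self, s.e₂_e₁₂, lie_zero]; module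
theorem e₁₂_e₁₁₂ : ⁅⁅e₁, e₂⁆, ⁅e₁, ⁅e₁, e₂⁆⁆⁆ = (-1 : ℝ) • ⁅e₂, ⁅e₁, ⁅e₁, ⁅e₁, e₂⁆⁆⁆⁆ := by
  rw [lie_lie, s.e₂_e₁₁₂, lie_zero]; module
-- Since 4α₁ + 2α₂ is not a root, this vector must vanish. It equals both plus and minus [e₁₂,
-- e₁₁₁₂]: apply ad e₁ to [e₂, e₁₁₁₂], and to the same vector written as -[e₁₂, e₁₁₂].
theorem e₁_e₂₁₁₁₂ : ⁅e₁, ⁅e₂, ⁅e₁, ⁅e₁, ⁅e₁, e₂⁆⁆⁆⁆⁆ = 0 := by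
  have h : ⁅e₁, ⁅e₂, ⁅e₁, ⁅e₁, ⁅e₁, e₂⁆⁆⁆⁆⁆ = ⁅⁅e₁, e₂⁆, ⁅e₁, ⁅e₁, ⁅e₁, e₂⁆⁆⁆⁆ := by
    rw [leibniz_lie, s.ad_e₁, lie_zero, add_zero]
  have h' : (-1 : ℝ) • ⁅e₁, ⁅e₂, ⁅e₁, ⁅e₁, ⁅e₁, e₂⁆⁆⁆⁆⁆ = ⁅⁅e₁, e₂⁆, ⁅e₁, ⁅e₁, ⁅e₁, e₂⁆⁆⁆⁆ := by
    rw [← lie_smul, ← s.e₁₂_e₁₁₂, leibniz_lie, lie_self, zero_add]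
  have h₂ : (2 : ℝ) • ⁅e₁, ⁅e₂, ⁅e₁, ⁅e₁, ⁅e₁, e₂⁆⁆⁆⁆⁆ = 0 := by
    rw [← h] at h'
    rw [two_smul]
    nth_rewrite 1 [← h']
    module
  exact (smul_eq_zero.mp h₂).resolve_left two_ne_zero
-- e₂ commutes with e₁₂ and e₁₁₂, hence with their bracket -e₂₁₁₁₂.
theorem e₂_e₂₁₁₁₂ : ⁅e₂, ⁅e₂, ⁅e₁, ⁅e₁, ⁅e₁, e₂⁆⁆⁆⁆⁆ = 0 := by
  have h : (-1 : ℝ) • ⁅e₂, ⁅e₂, ⁅e₁, ⁅e₁, ⁅e₁, e₂⁆⁆⁆⁆⁆ = 0 := by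
    rw [← lie_smul, ← s.e₁₂_e₁₁₂, leibniz_lie, s.e₂_e₁₂, s.e₂_e₁₁₂, lie_zero, zero_lie, add_zero]
  exact (smul_eq_zero.mp h).resolve_left (by norm_num)
theorem f₁_e₂₁₁₁₂ : ⁅f₁, ⁅e₂, ⁅e₁, ⁅e₁, ⁅e₁, e₂⁆⁆⁆⁆⁆ = 0 := by
  rw [leibniz_lie, s.f₁_e₂, s.f₁_e₁₁₁₂, lie_smul, s.e₂_e₁₁₂]; simp
theorem f₂_e₂₁₁₁₂ : ⁅f₂, ⁅e₂, ⁅e₁, ⁅e₁, ⁅e₁, e₂⁆⁆⁆⁆⁆ = (1 : ℝ) • ⁅e₁, ⁅e₁, ⁅e₁, e₂⁆⁆⁆ := by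
  rw [leibniz_lie, s.f₂_e₂, s.f₂_e₁₁₁₂, smul_lie, s.h₂_e₁₁₁₂, lie_zero]; module

end IsSerreG₂

end SerreSystem

/-! ### The span of the root vectors -/

section Stable

variable {𝔏 : Type*} [LieRing 𝔏] [LieAlgebra ℝ 𝔏]

/-- By the Jacobi identity, the elements of M whose adjoint action preserves M form a Lie
subalgebra. Stability under the generators is therefore enough. -/
theorem lieSpan_le_of_lie_mem {G : Set 𝔏} {M : Submodule ℝ 𝔏} (hG : G ⊆ M)
    (h : ∀ g ∈ G, ∀ x ∈ M, ⁅g, x⁆ ∈ M) : (LieSubalgebra.lieSpan ℝ 𝔏 G).toSubmodule ≤ M := by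
  let K : LieSubalgebra ℝ 𝔏 :=
    { carrier := {x | x ∈ M ∧ ∀ m ∈ M, ⁅x, m⁆ ∈ M}
      add_mem' := fun {x y} hx hy =>
        ⟨M.add_mem hx.1 hy.1, fun m hm => by rw [add_lie]; exact M.add_mem (hx.2 m hm) (hy.2 m hm)⟩
      zero_mem' := ⟨M.zero_mem, fun m _ => by rw [zero_lie]; exact M.zero_mem⟩
      smul_mem' := fun c x hx =>
        ⟨M.smul_mem c hx.1, fun m hm => by rw [smul_lie]; exact M.smul_mem c (hx.2 m hm)⟩
      lie_mem' := fun {x y} hx hy =>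
        ⟨hx.2 y hy.1, fun m hm => by
          rw [lie_lie]; exact M.sub_mem (hx.2 _ (hy.2 m hm)) (hy.2 _ (hx.2 m hm))⟩ }
  have : LieSubalgebra.lieSpan ℝ 𝔏 G ≤ K :=
    LieSubalgebra.lieSpan_le.mpr fun g hg => ⟨hG hg, h g hg⟩
  exact fun x hx => (this hx).1

theorem lie_mem_span_range {ι : Type*} {v : ι → 𝔏} {g : 𝔏}
    (h : ∀ i, ⁅g, v i⁆ ∈ Submodule.span ℝ (range v)) {x : 𝔏}
    (hx : x ∈ Submodule.span ℝ (range v)) : ⁅g, x⁆ ∈ Submodule.span ℝ (range v) := by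
  have : Submodule.span ℝ (range v) ≤
      (Submodule.span ℝ (range v)).comap (LieAlgebra.ad ℝ 𝔏 g) := by
    rw [Submodule.span_le]
    rintro _ ⟨i, rfl⟩
    exact h i
  exact this hx

end Stable

namespace IsSerreG₂

section

variable {𝔏 : Type*} [LieRing 𝔏] [LieAlgebra ℝ 𝔏]

/-- The root vectors generated by two simple root vectors. -/
def halfBasis (e₁ e₂ : 𝔏) : Fin 6 → 𝔏 :=
  ![e₁, e₂, ⁅e₁, e₂⁆, ⁅e₁, ⁅e₁, e₂⁆⁆, ⁅e₁, ⁅e₁, ⁅e₁, e₂⁆⁆⁆, ⁅e₂, ⁅e₁, ⁅e₁, ⁅e₁, e₂⁆⁆⁆⁆]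

/-- Positive root vectors, negative root vectors, and Cartan elements. -/
def chevalleyBasis (e₁ e₂ f₁ f₂ h₁ h₂ : 𝔏) : (Fin 6 ⊕ Fin 6) ⊕ Fin 2 → 𝔏 :=
  Sum.elim (Sum.elim (halfBasis e₁ e₂) (halfBasis f₁ f₂)) ![h₁, h₂]

variable {e₁ e₂ f₁ f₂ h₁ h₂ : 𝔏}

/-- M is arbitrary so that the same statement serves the negative half through the Chevalley
involution `symm`. -/
theorem lie_halfBasis_mem (s : IsSerreG₂ e₁ e₂ f₁ f₂ h₁ h₂) {M : Submodule ℝ 𝔏}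
    (hp : ∀ i, halfBasis e₁ e₂ i ∈ M) (h₁M : h₁ ∈ M) (h₂M : h₂ ∈ M)
    (i : Fin 6) :
    ⁅e₁, halfBasis e₁ e₂ i⁆ ∈ M ∧ ⁅e₂, halfBasis e₁ e₂ i⁆ ∈ M ∧ ⁅f₁, halfBasis e₁ e₂ i⁆ ∈ M ∧
      ⁅f₂, halfBasis e₁ e₂ i⁆ ∈ M := by
  have c {g x : 𝔏} (y : 𝔏) (r : ℝ) (h : ⁅g, x⁆ = r • y) (hy : y ∈ M) : ⁅g, x⁆ ∈ M :=
    h ▸ M.smul_mem r hy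
  have z {g x : 𝔏} (h : ⁅g, x⁆ = 0) : ⁅g, x⁆ ∈ M := h ▸ M.zero_mem
  fin_cases i
  · exact ⟨z (lie_self _), c _ _ (lie_eq_neg_one_smul _ _) (hp 2), c _ _ s.f₁_e₁ h₁M, z s.f₂_e₁⟩
  · exact ⟨hp 2, z (lie_self _), z s.f₁_e₂, c _ _ s.f₂_e₂ h₂M⟩
  · exact ⟨hp 3, z s.e₂_e₁₂, c _ _ s.f₁_e₁₂ (hp 1), c _ _ s.f₂_e₁₂ (hp 0)⟩
  · exact ⟨hp 4, z s.e₂_e₁₁₂, c _ _ s.f₁_e₁₁₂ (hp 2), z s.f₂_e₁₁₂⟩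
  · exact ⟨z s.ad_e₁, hp 5, c _ _ s.f₁_e₁₁₁₂ (hp 3), z s.f₂_e₁₁₁₂⟩
  · exact ⟨z s.e₁_e₂₁₁₁₂, z s.e₂_e₂₁₁₁₂, z s.f₁_e₂₁₁₁₂, c _ _ s.f₂_e₂₁₁₁₂ (hp 4)⟩

/-- The bound by 14 on the dimension: the span contains the four generators and is stable under
their adjoint actions. No linear independence is involved, so it also applies to the abstract Serre
quotient. -/
theorem lieSpan_le_span_chevalleyBasis (s : IsSerreG₂ e₁ e₂ f₁ f₂ h₁ h₂) :
    (LieSubalgebra.lieSpan ℝ 𝔏 {e₁, e₂, f₁, f₂}).toSubmodule ≤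
      Submodule.span ℝ (range (chevalleyBasis e₁ e₂ f₁ f₂ h₁ h₂)) := by
  have hM (i) : chevalleyBasis e₁ e₂ f₁ f₂ h₁ h₂ i ∈
      Submodule.span ℝ (range (chevalleyBasis e₁ e₂ f₁ f₂ h₁ h₂)) :=
    Submodule.subset_span (mem_range_self i)
  have hp (i) : halfBasis e₁ e₂ i ∈ Submodule.span ℝ (range (chevalleyBasis e₁ e₂ f₁ f₂ h₁ h₂)) :=
    hM (.inl (.inl i))
  have hn (i) : halfBasis f₁ f₂ i ∈ Submodule.span ℝ (range (chevalleyBasis e₁ e₂ f₁ f₂ h₁ h₂)) :=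
    hM (.inl (.inr i))
  have h₁M := hM (.inr 0)
  have h₂M := hM (.inr 1)
  change h₁ ∈ _ at h₁M
  change h₂ ∈ _ at h₂M
  have a := s.lie_halfBasis_mem hp h₁M h₂M
  have b := s.symm.lie_halfBasis_mem hn (neg_mem h₁M) (neg_mem h₂M)
  have c {M : Submodule ℝ 𝔏} {g h x : 𝔏} {r : ℝ} (e : ⁅g, -h⁆ = r • x) (hx : x ∈ M) :
      ⁅g, h⁆ ∈ M := by
    rw [← neg_mem_iff, ← lie_neg, e]
    exact M.smul_mem r hx
  apply lieSpan_le_of_lie_mem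
  · rintro _ (rfl | rfl | rfl | rfl)
    exacts [hp 0, hp 1, hn 0, hn 1]
  · rintro _ (rfl | rfl | rfl | rfl) x hx <;> refine lie_mem_span_range (fun i => ?_) hx
    · obtain (i | i) | i := i
      · exact (a i).1
      · exact (b i).2.2.1
      · fin_cases i
        · exact s.e₁_h₁ ▸ Submodule.smul_mem _ _ (hp 0)
        · exact s.e₁_h₂ ▸ Submodule.smul_mem _ _ (hp 0)
    · obtain (i | i) | i := i
      · exact (a i).2.1
      · exact (b i).2.2.2
      · fin_cases i
        · exact s.e₂_h₁ ▸ Submodule.smul_mem _ _ (hp 1)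
        · exact s.e₂_h₂ ▸ Submodule.smul_mem _ _ (hp 1)
    · obtain (i | i) | i := i
      · exact (a i).2.2.1
      · exact (b i).1
      · fin_cases i
        · exact c s.symm.e₁_h₁ (hn 0)
        · exact c s.symm.e₁_h₂ (hn 0)
    · obtain (i | i) | i := i
      · exact (a i).2.2.2
      · exact (b i).2.1
      · fin_cases i
        · exact c s.symm.e₂_h₁ (hn 1)
        · exact c s.symm.e₂_h₂ (hn 1)

/-- The root vectors of a bracket-generating triple, in terms of Chevalley generators. -/
theorem rootVector_eq (s : IsSerreG₂ e₁ e₂ f₁ f₂ h₁ h₂) :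
    BracketG2.rootVector e₁ ⁅e₁, e₂⁆ ((1 / 2 : ℝ) • ⁅f₁, ⁅f₁, f₂⁆⁆) =
      ![e₁, ⁅e₁, e₂⁆, (1 / 2 : ℝ) • ⁅f₁, ⁅f₁, f₂⁆⁆, ⁅e₁, ⁅e₁, e₂⁆⁆, (2 : ℝ) • f₁,
        (-2 : ℝ) • ⁅f₁, f₂⁆, ⁅e₁, ⁅e₁, ⁅e₁, e₂⁆⁆⁆, (-1 : ℝ) • ⁅e₂, ⁅e₁, ⁅e₁, ⁅e₁, e₂⁆⁆⁆⁆,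
        (-6 : ℝ) • e₂, (-1 : ℝ) • ⁅f₁, ⁅f₁, ⁅f₁, f₂⁆⁆⁆, (-1 : ℝ) • ⁅f₂, ⁅f₁, ⁅f₁, ⁅f₁, f₂⁆⁆⁆⁆,
        (-6 : ℝ) • f₂] := by
  have h5 : ⁅⁅e₁, e₂⁆, (1 / 2 : ℝ) • ⁅f₁, ⁅f₁, f₂⁆⁆⁆ = (2 : ℝ) • f₁ := by
    rw [lie_smul, lie_lie, s.symm.f₂_e₁₁₂, s.symm.f₁_e₁₁₂, lie_smul, s.symm.f₂_e₁₂, lie_zero]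
    module
  have h6 : ⁅(1 / 2 : ℝ) • ⁅f₁, ⁅f₁, f₂⁆⁆, e₁⁆ = (-2 : ℝ) • ⁅f₁, f₂⁆ := by
    rw [smul_lie, ← lie_skew, s.symm.f₁_e₁₁₂]
    module
  have l3 : ⁅⁅e₁, e₂⁆, (2 : ℝ) • f₁⁆ = (-6 : ℝ) • e₂ := by
    rw [lie_smul, ← lie_skew, s.f₁_e₁₂]
    module
  have l4 : ⁅(1 / 2 : ℝ) • ⁅f₁, ⁅f₁, f₂⁆⁆, (2 : ℝ) • f₁⁆ =
      (-1 : ℝ) • ⁅f₁, ⁅f₁, ⁅f₁, f₂⁆⁆⁆ := by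
    rw [smul_lie, lie_smul, ← lie_skew]
    module
  have l5 : ⁅(1 / 2 : ℝ) • ⁅f₁, ⁅f₁, f₂⁆⁆, (-2 : ℝ) • ⁅f₁, f₂⁆⁆ =
      (-1 : ℝ) • ⁅f₂, ⁅f₁, ⁅f₁, ⁅f₁, f₂⁆⁆⁆⁆ := by
    rw [smul_lie, lie_smul, ← lie_skew, s.symm.e₁₂_e₁₁₂]
    module
  have l6 : ⁅e₁, (-2 : ℝ) • ⁅f₁, f₂⁆⁆ = (-6 : ℝ) • f₂ := by
    rw [lie_smul, s.symm.f₁_e₁₂]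
    module
  simp only [BracketG2.rootVector, h5, h6, l3, l4, l5, l6, s.e₁₂_e₁₁₂]

theorem cartanVector_eq (s : IsSerreG₂ e₁ e₂ f₁ f₂ h₁ h₂) :
    BracketG2.cartanVector e₁ ⁅e₁, e₂⁆ ((1 / 2 : ℝ) • ⁅f₁, ⁅f₁, f₂⁆⁆) =
      ![(1 / 2 : ℝ) • h₁, (√3 / 2 : ℝ) • h₁ + (√3 : ℝ) • h₂] := by
  have h6 : ⁅(1 / 2 : ℝ) • ⁅f₁, ⁅f₁, f₂⁆⁆, e₁⁆ = (-2 : ℝ) • ⁅f₁, f₂⁆ := by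
    rw [smul_lie, ← lie_skew, s.symm.f₁_e₁₁₂]
    module
  have a : ⁅⁅e₁, e₂⁆, ⁅f₁, f₂⁆⁆ = -h₁ - (3 : ℝ) • h₂ := by
    rw [lie_lie, s.symm.f₂_e₁₂, s.symm.f₁_e₁₂, lie_smul, lie_smul, s.e₁_f₁, s.e₂_f₂]
    module
  have b : ⁅⁅e₁, e₂⁆, ⁅f₁, ⁅f₁, f₂⁆⁆⁆ = (4 : ℝ) • f₁ := by
    rw [lie_lie, s.symm.f₂_e₁₁₂, s.symm.f₁_e₁₁₂, lie_smul, s.symm.f₂_e₁₂, lie_zero]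
    module
  have c : ⁅⁅e₁, ⁅e₁, e₂⁆⁆, (1 / 2 : ℝ) • ⁅f₁, ⁅f₁, f₂⁆⁆⁆ = (4 : ℝ) • h₁ + (6 : ℝ) • h₂ := by
    rw [lie_smul, lie_lie, b, s.symm.f₁_e₁₁₂, lie_smul, lie_smul, a, s.e₁_f₁]
    module
  have d : ⁅⁅e₁, e₂⁆, (-2 : ℝ) • ⁅f₁, f₂⁆⁆ = (2 : ℝ) • h₁ + (6 : ℝ) • h₂ := by
    rw [lie_smul, a]
    module
  simp only [BracketG2.cartanVector, h6, c, d]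
  congr 1
  · module
  · congr 1
    module

/-- A vector with eigenvalues (a, b) under (h₁, h₂) sits at the point (a/2, √3(a/2 + b)) of the root
diagram. For negative roots the eigenvalues come from the Chevalley involution with reversed sign.
-/
theorem root_eq (s : IsSerreG₂ e₁ e₂ f₁ f₂ h₁ h₂) (i : Fin 12) :
    ⁅(1 / 2 : ℝ) • h₁, BracketG2.rootVector e₁ ⁅e₁, e₂⁆ ((1 / 2 : ℝ) • ⁅f₁, ⁅f₁, f₂⁆⁆) i⁆ =
        (BracketG2.rootPosition i).1 •
          BracketG2.rootVector e₁ ⁅e₁, e₂⁆ ((1 / 2 : ℝ) • ⁅f₁, ⁅f₁, f₂⁆⁆) i ∧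
      ⁅(√3 / 2 : ℝ) • h₁ + (√3 : ℝ) • h₂,
          BracketG2.rootVector e₁ ⁅e₁, e₂⁆ ((1 / 2 : ℝ) • ⁅f₁, ⁅f₁, f₂⁆⁆) i⁆ =
        (BracketG2.rootPosition i).2 •
          BracketG2.rootVector e₁ ⁅e₁, e₂⁆ ((1 / 2 : ℝ) • ⁅f₁, ⁅f₁, f₂⁆⁆) i := by
  have key {v : 𝔏} {a b c d x : ℝ} (ha : ⁅h₁, v⁆ = a • v) (hb : ⁅h₂, v⁆ = b • v)
      (hc : c = 1 / 2 * a) (hd : d = √3 / 2 * a + √3 * b) :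
      ⁅(1 / 2 : ℝ) • h₁, x • v⁆ = c • x • v ∧
        ⁅(√3 / 2 : ℝ) • h₁ + (√3 : ℝ) • h₂, x • v⁆ = d • x • v := by
    subst hc hd
    constructor
    · rw [lie_smul, smul_lie, ha]; module
    · rw [lie_smul, add_lie, smul_lie, smul_lie, ha, hb]; module
  have key' {v : 𝔏} {a b c d : ℝ} (ha : ⁅h₁, v⁆ = a • v) (hb : ⁅h₂, v⁆ = b • v)
      (hc : c = 1 / 2 * a) (hd : d = √3 / 2 * a + √3 * b) :
      ⁅(1 / 2 : ℝ) • h₁, v⁆ = c • v ∧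
        ⁅(√3 / 2 : ℝ) • h₁ + (√3 : ℝ) • h₂, v⁆ = d • v := by
    simpa using key (x := 1) ha hb hc hd
  have neg {h v : 𝔏} {a : ℝ} (ha : ⁅-h, v⁆ = a • v) : ⁅h, v⁆ = (-a) • v := by
    rw [neg_smul, ← ha, neg_lie, neg_neg]
  rw [s.rootVector_eq]
  fin_cases i
  · refine key' s.h₁_e₁ s.h₂_e₁ ?_ ?_ <;>
      norm_num [BracketG2.rootPosition]
  · refine key' s.h₁_e₁₂ s.h₂_e₁₂ (by norm_num [BracketG2.rootPosition]) ?_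
    norm_num [BracketG2.rootPosition]
    ring
  · refine key (neg s.symm.h₁_e₁₁₂) (neg s.symm.h₂_e₁₁₂) (by norm_num [BracketG2.rootPosition]) ?_
    norm_num [BracketG2.rootPosition]
    ring
  · refine key' s.h₁_e₁₁₂ s.h₂_e₁₁₂ ?_ ?_ <;>
      norm_num [BracketG2.rootPosition]
  · refine key s.h₁_f₁ s.h₂_f₁ ?_ ?_ <;>
      norm_num [BracketG2.rootPosition]
  · refine key (neg s.symm.h₁_e₁₂) (neg s.symm.h₂_e₁₂) (by norm_num [BracketG2.rootPosition]) ?_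
    norm_num [BracketG2.rootPosition]
    ring
  · refine key' s.h₁_e₁₁₁₂ s.h₂_e₁₁₁₂ (by norm_num [BracketG2.rootPosition]) ?_
    norm_num [BracketG2.rootPosition]
    ring
  · refine key s.h₁_e₂₁₁₁₂ s.h₂_e₂₁₁₁₂ ?_ ?_ <;>
      norm_num [BracketG2.rootPosition]
  · refine key s.h₁_e₂ s.h₂_e₂ (by norm_num [BracketG2.rootPosition]) ?_
    norm_num [BracketG2.rootPosition]
    ring
  · refine key (neg s.symm.h₁_e₁₁₁₂) (neg s.symm.h₂_e₁₁₁₂) (by norm_num [BracketG2.rootPosition]) ?_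
    norm_num [BracketG2.rootPosition]
    ring
  · refine key (neg s.symm.h₁_e₂₁₁₁₂) (neg s.symm.h₂_e₂₁₁₁₂) ?_ ?_ <;>
      norm_num [BracketG2.rootPosition]
  · refine key s.h₁_f₂ s.h₂_f₂ (by norm_num [BracketG2.rootPosition]) ?_
    norm_num [BracketG2.rootPosition]
    ring

end

end IsSerreG₂

noncomputable section

namespace IsSerreG₂

/-! ### The presentation of 𝔤₂ by Serre relations -/

section Presentation

open CartanMatrix

/-- The free Lie algebra on the Chevalley generators of type `G₂`. -/
abbrev FreeG₂ : Type := FreeLieAlgebra ℝ (Generators (Fin 2))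

/-- The ideal of the Serre relations of type `G₂`. -/
abbrev serreIdeal : LieIdeal ℝ FreeG₂ := Relations.toIdeal ℝ G₂

/-- The projection from the free Lie algebra to `𝔤₂`. -/
def serreProj : FreeG₂ →ₗ⁅ℝ⁆ FreeG₂ ⧸ serreIdeal :=
  { serreIdeal.toSubmodule.mkQ with map_lie' := rfl }

/-- A generator in the free Lie algebra. -/
abbrev gen (x : Generators (Fin 2)) : FreeG₂ := FreeLieAlgebra.of ℝ x

theorem serreProj_eq_zero {x : FreeG₂} : serreProj x = 0 ↔ x ∈ serreIdeal :=
  Submodule.Quotient.mk_eq_zero _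

theorem serreProj_surjective : Function.Surjective serreProj :=
  Submodule.mkQ_surjective _

theorem serreProj_relation {x : FreeG₂} (hx : x ∈ Relations.toSet ℝ G₂) : serreProj x = 0 :=
  serreProj_eq_zero.mpr (LieSubmodule.subset_lieSpan hx)

theorem isSerreG₂_serreProj :
    IsSerreG₂ (serreProj (gen (.E 0))) (serreProj (gen (.E 1))) (serreProj (gen (.F 0)))
      (serreProj (gen (.F 1))) (serreProj (gen (.H 0))) (serreProj (gen (.H 1))) := by
  have hHH (i j) := serreProj_relation (x := Relations.HH ℝ (i, j)) (by simp [Relations.toSet])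
  have hEF (i j) := serreProj_relation (x := Relations.EF ℝ (i, j)) (by simp [Relations.toSet])
  have hHE (i j) := serreProj_relation (x := Relations.HE ℝ G₂ (i, j)) (by simp [Relations.toSet])
  have hHF (i j) := serreProj_relation (x := Relations.HF ℝ G₂ (i, j)) (by simp [Relations.toSet])
  have hE (i j) := serreProj_relation (x := Relations.adE ℝ G₂ (i, j)) (by simp [Relations.toSet])
  have hF (i j) := serreProj_relation (x := Relations.adF ℝ G₂ (i, j)) (by simp [Relations.toSet])
  have E01 := hE 0 1
  have E10 := hE 1 0
  have F01 := hF 0 1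
  have F10 := hF 1 0
  simp only [Relations.HH, Relations.EF, Relations.HE, Relations.HF, Relations.adE, Relations.adF,
    Function.uncurry_apply_pair, Function.comp_apply] at hHH hEF hHE hHF E01 E10 F01 F10
  -- The Serre relation applies a power of ad Eᵢ to [Eᵢ, Eⱼ], which already contains one bracket.
  -- Exponents 3 and 1 thus mean four-fold and two-fold brackets.
  have t3 : (-G₂ 0 1).toNat = 3 := rfl
  have t1 : (-G₂ 1 0).toNat = 1 := rfl
  rw [t3] at E01 F01
  rw [t1] at E10 F10
  simp only [pow_succ, pow_zero, one_mul, Module.End.mul_apply, LieAlgebra.ad_apply, LieHom.map_lie]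
    at E01 E10 F01 F10
  have he (i j) : ⁅serreProj (gen (.H i)), serreProj (gen (.E j))⁆ =
      (G₂ i j : ℝ) • serreProj (gen (.E j)) := by
    rw [← LieHom.map_lie, Int.cast_smul_eq_zsmul, ← map_zsmul, ← sub_eq_zero, ← map_sub]
    exact hHE i j
  have hf (i j) : ⁅serreProj (gen (.H i)), serreProj (gen (.F j))⁆ =
      (-G₂ i j : ℝ) • serreProj (gen (.F j)) := by
    rw [← LieHom.map_lie, neg_smul, Int.cast_smul_eq_zsmul, ← map_zsmul, ← sub_eq_zero,
      sub_neg_eq_add, ← map_add]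
    exact hHF i j
  constructor
  · exact hHH 0 1
  · exact sub_eq_zero.mp (by simpa using hEF 0 0)
  · exact sub_eq_zero.mp (by simpa using hEF 1 1)
  · simpa using hEF 0 1
  · simpa using hEF 1 0
  · simpa [G₂] using he 0 0
  · simpa [G₂] using he 0 1
  · simpa [G₂] using he 1 0
  · simpa [G₂] using he 1 1
  · simpa [G₂] using hf 0 0
  · simpa [G₂] using hf 0 1
  · simpa [G₂] using hf 1 0
  · simpa [G₂] using hf 1 1
  · exact E01
  · exact E10
  · exact F01
  · exact F10

/-- Hence 𝔤₂ has dimension at most 14. The four elements E and F generate the quotient, because each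
H is the bracket of an E with an F. -/
theorem span_chevalleyBasis_serreProj :
    Submodule.span ℝ (range (chevalleyBasis (serreProj (gen (.E 0))) (serreProj (gen (.E 1)))
      (serreProj (gen (.F 0))) (serreProj (gen (.F 1))) (serreProj (gen (.H 0)))
      (serreProj (gen (.H 1))))) = ⊤ := by
  have s := isSerreG₂_serreProj
  refine top_unique (le_trans (fun x _ => ?_) s.lieSpan_le_span_chevalleyBasis)
  set K := LieSubalgebra.lieSpan ℝ (FreeG₂ ⧸ serreIdeal) {serreProj (gen (.E 0)),
    serreProj (gen (.E 1)), serreProj (gen (.F 0)), serreProj (gen (.F 1))} with hK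
  have he (i) : serreProj (gen (.E i)) ∈ K := by
    fin_cases i <;> exact LieSubalgebra.subset_lieSpan (by simp)
  have hf (i) : serreProj (gen (.F i)) ∈ K := by
    fin_cases i <;> exact LieSubalgebra.subset_lieSpan (by simp)
  have hh (i) : serreProj (gen (.H i)) ∈ K := by
    fin_cases i
    · exact s.e₁_f₁ ▸ K.lie_mem (he 0) (hf 0)
    · exact s.e₂_f₂ ▸ K.lie_mem (he 1) (hf 1)
  have hg (g : Generators (Fin 2)) : serreProj (gen g) ∈ K := by
    cases g with
    | H i => exact hh i
    | E i => exact he i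
    | F i => exact hf i
  obtain ⟨y, rfl⟩ := serreProj_surjective x
  -- The projection agrees on free generators with a homomorphism that factors through K, so its
  -- whole image lies in K.
  have : K.incl.comp (FreeLieAlgebra.lift ℝ fun g => (⟨serreProj (gen g), hg g⟩ : K)) =
      serreProj := by
    ext g
    simp
  rw [← this]
  exact Subtype.prop _

variable {𝔏 : Type*} [LieRing 𝔏] [LieAlgebra ℝ 𝔏] {e₁ e₂ f₁ f₂ h₁ h₂ : 𝔏}

/-- The homomorphism from the free Lie algebra given by six elements. -/
def freeHom (e₁ e₂ f₁ f₂ h₁ h₂ : 𝔏) : FreeG₂ →ₗ⁅ℝ⁆ 𝔏 :=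
  FreeLieAlgebra.lift ℝ fun
    | .E i => ![e₁, e₂] i
    | .F i => ![f₁, f₂] i
    | .H i => ![h₁, h₂] i

theorem serreIdeal_le_ker (s : IsSerreG₂ e₁ e₂ f₁ f₂ h₁ h₂) :
    serreIdeal ≤ (freeHom e₁ e₂ f₁ f₂ h₁ h₂).ker := by
  have hE (i) : freeHom e₁ e₂ f₁ f₂ h₁ h₂ (gen (.E i)) = ![e₁, e₂] i := by simp [freeHom]
  have hF (i) : freeHom e₁ e₂ f₁ f₂ h₁ h₂ (gen (.F i)) = ![f₁, f₂] i := by simp [freeHom]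
  have hH (i) : freeHom e₁ e₂ f₁ f₂ h₁ h₂ (gen (.H i)) = ![h₁, h₂] i := by simp [freeHom]
  have t3 : (-G₂ 0 1).toNat = 3 := rfl
  have t1 : (-G₂ 1 0).toNat = 1 := rfl
  refine LieSubmodule.lieSpan_le.mpr ?_
  rintro _ (((((⟨⟨i, j⟩, rfl⟩ | ⟨⟨i, j⟩, rfl⟩) | ⟨⟨i, j⟩, rfl⟩) | ⟨⟨i, j⟩, rfl⟩) |
    ⟨⟨i, j⟩, rfl⟩) | ⟨⟨i, j⟩, rfl⟩)
  all_goals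
    rw [SetLike.mem_coe, LieHom.mem_ker]
    simp only [Relations.HH, Relations.EF, Relations.HE, Relations.HF, Relations.adE,
      Relations.adF, Function.uncurry_apply_pair, Function.comp_apply]
  · rw [LieHom.map_lie, hH, hH]
    fin_cases i <;> fin_cases j
    · exact lie_self _
    · exact s.h₁_h₂
    · exact (lie_skew _ _).symm.trans (neg_eq_zero.mpr s.h₁_h₂)
    · exact lie_self _
  · split_ifs with h
    · subst h
      rw [map_sub, LieHom.map_lie, hH, hE, hF, sub_eq_zero]
      fin_cases i
      exacts [s.e₁_f₁, s.e₂_f₂]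
    · rw [LieHom.map_lie, hE, hF]
      fin_cases i <;> fin_cases j
      exacts [absurd rfl h, s.e₁_f₂, s.e₂_f₁, absurd rfl h]
  · rw [map_sub, LieHom.map_lie, hH, map_zsmul, hE, sub_eq_zero, ← Int.cast_smul_eq_zsmul ℝ]
    fin_cases i <;> fin_cases j
    · simpa [G₂] using s.h₁_e₁
    · simpa [G₂] using s.h₁_e₂
    · simpa [G₂] using s.h₂_e₁
    · simpa [G₂] using s.h₂_e₂
  · rw [map_add, LieHom.map_lie, hH, map_zsmul, hF, add_eq_zero_iff_eq_neg,
      ← Int.cast_smul_eq_zsmul ℝ, ← neg_smul]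
    fin_cases i <;> fin_cases j
    · simpa [G₂] using s.h₁_f₁
    · simpa [G₂] using s.h₁_f₂
    · simpa [G₂] using s.h₂_f₁
    · simpa [G₂] using s.h₂_f₂
  · fin_cases i <;> fin_cases j <;>
      simp [pow_succ, t1, t3, hE, s.ad_e₁, s.ad_e₂]
  · fin_cases i <;> fin_cases j <;>
      simp [pow_succ, t1, t3, hF, s.ad_f₁, s.ad_f₂]

theorem map_chevalleyBasis {𝔏' : Type*} [LieRing 𝔏'] [LieAlgebra ℝ 𝔏'] (φ : 𝔏 →ₗ⁅ℝ⁆ 𝔏')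
    (e₁ e₂ f₁ f₂ h₁ h₂ : 𝔏) (i) :
    φ (chevalleyBasis e₁ e₂ f₁ f₂ h₁ h₂ i) =
      chevalleyBasis (φ e₁) (φ e₂) (φ f₁) (φ f₂) (φ h₁) (φ h₂) i := by
  obtain (i | i) | i := i <;> fin_cases i <;> simp [chevalleyBasis, halfBasis]

/-- Modulo the Serre ideal, a kernel element is a combination of the 14 spanning vectors. Their
images are independent, so all its coefficients vanish. -/
theorem serreIdeal_eq_ker (s : IsSerreG₂ e₁ e₂ f₁ f₂ h₁ h₂)
    (li : LinearIndependent ℝ (chevalleyBasis e₁ e₂ f₁ f₂ h₁ h₂)) :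
    serreIdeal = (freeHom e₁ e₂ f₁ f₂ h₁ h₂).ker := by
  refine le_antisymm s.serreIdeal_le_ker fun x hx => ?_
  have hx' : serreProj x ∈ (⊤ : Submodule ℝ (FreeG₂ ⧸ serreIdeal)) := trivial
  rw [← span_chevalleyBasis_serreProj, Submodule.mem_span_range_iff_exists_fun] at hx'
  obtain ⟨c, hc⟩ := hx'
  simp only [← map_chevalleyBasis, ← map_smul, ← map_sum] at hc
  rw [← sub_eq_zero, ← map_sub, serreProj_eq_zero] at hc
  have h := s.serreIdeal_le_ker hc
  rw [LieHom.mem_ker] at h hx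
  rw [map_sub, hx, sub_zero, map_sum] at h
  simp only [map_smul, map_chevalleyBasis] at h
  have h0 := Fintype.linearIndependent_iff.mp li c (by simpa [freeHom] using h)
  simpa [h0] using hc

theorem range_freeHom (s : IsSerreG₂ e₁ e₂ f₁ f₂ h₁ h₂) :
    (freeHom e₁ e₂ f₁ f₂ h₁ h₂).range = LieSubalgebra.lieSpan ℝ 𝔏 {e₁, e₂, f₁, f₂} := by
  set K := LieSubalgebra.lieSpan ℝ 𝔏 {e₁, e₂, f₁, f₂}
  apply le_antisymm
  · have he (i) : ![e₁, e₂] i ∈ K := by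
      fin_cases i <;> exact LieSubalgebra.subset_lieSpan (by simp)
    have hf (i) : ![f₁, f₂] i ∈ K := by
      fin_cases i <;> exact LieSubalgebra.subset_lieSpan (by simp)
    have hh (i) : ![h₁, h₂] i ∈ K := by
      fin_cases i
      · exact s.e₁_f₁ ▸ K.lie_mem (he 0) (hf 0)
      · exact s.e₂_f₂ ▸ K.lie_mem (he 1) (hf 1)
    have hg (g : Generators (Fin 2)) : freeHom e₁ e₂ f₁ f₂ h₁ h₂ (gen g) ∈ K := by
      cases g with
      | H i => simpa [freeHom] using hh i
      | E i => simpa [freeHom] using he i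
      | F i => simpa [freeHom] using hf i
    have : K.incl.comp (FreeLieAlgebra.lift ℝ fun g =>
        (⟨freeHom e₁ e₂ f₁ f₂ h₁ h₂ (gen g), hg g⟩ : K)) = freeHom e₁ e₂ f₁ f₂ h₁ h₂ := by
      ext g
      simp
    rintro _ ⟨x, rfl⟩
    rw [← this]
    exact Subtype.prop _
  · rw [LieSubalgebra.lieSpan_le]
    rintro _ (rfl | rfl | rfl | rfl)
    · exact ⟨gen (.E 0), by simp [freeHom]⟩
    · exact ⟨gen (.E 1), by simp [freeHom]⟩
    · exact ⟨gen (.F 0), by simp [freeHom]⟩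
    · exact ⟨gen (.F 1), by simp [freeHom]⟩

/-- A Lie algebra generated by a nondegenerate Serre system of type `G₂` is split `𝔤₂`. -/
theorem nonempty_equiv_g₂ (s : IsSerreG₂ e₁ e₂ f₁ f₂ h₁ h₂)
    (li : LinearIndependent ℝ (chevalleyBasis e₁ e₂ f₁ f₂ h₁ h₂)) :
    Nonempty (LieSubalgebra.lieSpan ℝ 𝔏 {e₁, e₂, f₁, f₂} ≃ₗ⁅ℝ⁆ LieAlgebra.g₂ ℝ) := by
  rw [← s.range_freeHom]
  have : Nonempty ((freeHom e₁ e₂ f₁ f₂ h₁ h₂).range ≃ₗ⁅ℝ⁆ (FreeG₂ ⧸ serreIdeal)) := by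
    rw [s.serreIdeal_eq_ker li]
    exact ⟨(LieHom.quotKerEquivRange _).symm⟩
  exact this

end Presentation

end IsSerreG₂

end

/-! ### Cartan subalgebras from a root space decomposition -/

section CartanSubalgebra

variable {𝔏 ι κ : Type*} [LieRing 𝔏] [LieAlgebra ℝ 𝔏] [Fintype ι]

/-- The span of a family of commuting elements that act diagonally and without common kernel on a
complement is a Cartan subalgebra. -/
theorem exists_isCartanSubalgebra_of_roots {K : LieSubalgebra ℝ 𝔏} {r : ι → 𝔏} {c : κ → 𝔏}
    {α : κ → ι → ℝ} (hli : LinearIndependent ℝ (Sum.elim r c))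
    (hspan : Submodule.span ℝ (range (Sum.elim r c)) = K.toSubmodule)
    (hr : ∀ j i, ⁅c j, r i⁆ = α j i • r i) (hc : ∀ j j', ⁅c j, c j'⁆ = 0)
    (hα : ∀ i, ∃ j, α j i ≠ 0) :
    ∃ 𝔥 : LieSubalgebra ℝ K, 𝔥.IsCartanSubalgebra ∧
      𝔥.toSubmodule.map K.toSubmodule.subtype = Submodule.span ℝ (range c) := by
  have hcK : Submodule.span ℝ (range c) ≤ K.toSubmodule := by
    rw [← hspan, Sum.elim_range, Submodule.span_union]
    exact le_sup_right
  have comm_gen (j : κ) {y : 𝔏} (hy : y ∈ Submodule.span ℝ (range c)) : ⁅c j, y⁆ = 0 := by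
    have : Submodule.span ℝ (range c) ≤ LinearMap.ker (LieAlgebra.ad ℝ 𝔏 (c j)) := by
      rw [Submodule.span_le]
      rintro _ ⟨j', rfl⟩
      exact hc j j'
    exact this hy
  have comm {x y : 𝔏} (hx : x ∈ Submodule.span ℝ (range c))
      (hy : y ∈ Submodule.span ℝ (range c)) : ⁅x, y⁆ = 0 := by
    have : Submodule.span ℝ (range c) ≤ LinearMap.ker (LieAlgebra.ad ℝ 𝔏 y) := by
      rw [Submodule.span_le]
      rintro _ ⟨j, rfl⟩
      change ⁅y, c j⁆ = 0
      rw [← lie_skew, comm_gen j hy, neg_zero]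
    rw [← lie_skew, show ⁅y, x⁆ = 0 from this hx, neg_zero]
  let 𝔥 : LieSubalgebra ℝ K :=
    { (Submodule.span ℝ (range c)).comap K.toSubmodule.subtype with
      lie_mem' := fun {x y} hx hy => by
        change (⁅(x : 𝔏), (y : 𝔏)⁆ : 𝔏) ∈ Submodule.span ℝ (range c)
        rw [show ⁅(x : 𝔏), (y : 𝔏)⁆ = 0 from comm hx hy]
        exact zero_mem _ }
  have mem (x : K) : x ∈ 𝔥 ↔ (x : 𝔏) ∈ Submodule.span ℝ (range c) := Iff.rfl
  have : IsLieAbelian 𝔥 := ⟨fun x y => Subtype.ext (Subtype.ext (comm x.2 y.2))⟩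
  refine ⟨𝔥, ⟨inferInstance, ?_⟩, ?_⟩
  · refine le_antisymm (fun x hx => ?_) 𝔥.le_normalizer
    rw [LieSubalgebra.mem_normalizer_iff'] at hx
    have hx' : (x : 𝔏) ∈ Submodule.span ℝ (range (Sum.elim r c)) := hspan ▸ x.2
    rw [Sum.elim_range, Submodule.span_union, Submodule.mem_sup] at hx'
    obtain ⟨u, hu, v, hv, huv⟩ := hx'
    obtain ⟨a, rfl⟩ := Submodule.mem_span_range_iff_exists_fun ℝ |>.mp hu
    obtain ⟨hlr, -, hdisj⟩ := linearIndependent_sum.mp hli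
    -- If x normalises 𝔥, then [cⱼ, x] = Σ aᵢ αⱼᵢ rᵢ lies in the span of the c's and, by
    -- independence, must be zero. Since every i has some αⱼᵢ ≠ 0, x has no root component.
    have key (j : κ) (i : ι) : a i * α j i = 0 := by
      have h := hx ⟨c j, hcK (Submodule.subset_span (mem_range_self j))⟩
        (Submodule.subset_span (mem_range_self j))
      rw [mem] at h
      change ⁅c j, (x : 𝔏)⁆ ∈ _ at h
      rw [← huv, lie_add, comm_gen j hv, add_zero, lie_sum] at h
      simp only [lie_smul, hr, smul_smul] at h
      refine Fintype.linearIndependent_iff.mp hlr (fun i => a i * α j i) ?_ i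
      exact Submodule.disjoint_def.mp hdisj _ (Submodule.sum_mem _ fun i _ =>
        Submodule.smul_mem _ _ (Submodule.subset_span (mem_range_self i))) h
    have ha (i : ι) : a i = 0 := by
      obtain ⟨j, hj⟩ := hα i
      exact (mul_eq_zero.mp (key j i)).resolve_right hj
    rw [mem, ← huv]
    simpa [ha] using hv
  · change ((Submodule.span ℝ (range c)).comap K.toSubmodule.subtype).map _ = _
    rw [Submodule.map_comap_subtype, inf_eq_right]
    exact hcK

end CartanSubalgebra

/-! ### From Serre systems to bracket-generating triples -/

namespace IsSerreG₂

variable {𝔏 : Type*} [LieRing 𝔏] [LieAlgebra ℝ 𝔏] {e₁ e₂ f₁ f₂ h₁ h₂ : 𝔏}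

/-- The two families differ only by nonzero scalars on root vectors and by an invertible triangular
change on the Cartan part. -/
theorem chevalleyBasis_mem_span (s : IsSerreG₂ e₁ e₂ f₁ f₂ h₁ h₂) (i) :
    chevalleyBasis e₁ e₂ f₁ f₂ h₁ h₂ i ∈ Submodule.span ℝ (range (Sum.elim
      (BracketG2.rootVector e₁ ⁅e₁, e₂⁆ ((1 / 2 : ℝ) • ⁅f₁, ⁅f₁, f₂⁆⁆))
      (BracketG2.cartanVector e₁ ⁅e₁, e₂⁆ ((1 / 2 : ℝ) • ⁅f₁, ⁅f₁, f₂⁆⁆)))) := by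
  have hM (i) := Submodule.subset_span (R := ℝ) (mem_range_self (f := Sum.elim
      (BracketG2.rootVector e₁ ⁅e₁, e₂⁆ ((1 / 2 : ℝ) • ⁅f₁, ⁅f₁, f₂⁆⁆))
      (BracketG2.cartanVector e₁ ⁅e₁, e₂⁆ ((1 / 2 : ℝ) • ⁅f₁, ⁅f₁, f₂⁆⁆))) i)
  generalize hMd : Submodule.span ℝ (range (Sum.elim
      (BracketG2.rootVector e₁ ⁅e₁, e₂⁆ ((1 / 2 : ℝ) • ⁅f₁, ⁅f₁, f₂⁆⁆))
      (BracketG2.cartanVector e₁ ⁅e₁, e₂⁆ ((1 / 2 : ℝ) • ⁅f₁, ⁅f₁, f₂⁆⁆)))) = M at hM ⊢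
  rw [s.rootVector_eq, s.cartanVector_eq] at hM
  have c {x : 𝔏} {r : ℝ} (hr : r ≠ 0) (h : r • x ∈ M) : x ∈ M := (M.smul_mem_iff hr).mp h
  have m0 : h₁ ∈ M := c (by norm_num) (hM (.inr 0))
  have m1 : (√3 / 2 : ℝ) • h₁ + (√3 : ℝ) • h₂ ∈ M := hM (.inr 1)
  have m2 : h₂ ∈ M := c (r := √3) (by simp) ((M.add_mem_iff_right (M.smul_mem _ m0)).mp m1)
  obtain (i | i) | i := i <;> fin_cases i
  · exact hM (.inl 0)
  · exact c (by norm_num) (hM (.inl 8))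
  · exact hM (.inl 1)
  · exact hM (.inl 3)
  · exact hM (.inl 6)
  · exact c (by norm_num) (hM (.inl 7))
  · exact c (by norm_num) (hM (.inl 4))
  · exact c (by norm_num) (hM (.inl 11))
  · exact c (by norm_num) (hM (.inl 5))
  · exact c (by norm_num) (hM (.inl 2))
  · exact c (by norm_num) (hM (.inl 9))
  · exact c (by norm_num) (hM (.inl 10))
  · exact m0
  · exact m2

theorem rootVector_mem {S₁ S₂ S₃ : 𝔏} {K : LieSubalgebra ℝ 𝔏} (h₁ : S₁ ∈ K) (h₂ : S₂ ∈ K)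
    (h₃ : S₃ ∈ K) (i) :
    Sum.elim (BracketG2.rootVector S₁ S₂ S₃) (BracketG2.cartanVector S₁ S₂ S₃) i ∈ K := by
  have h4 := K.lie_mem h₁ h₂
  have h5 := K.lie_mem h₂ h₃
  have h6 := K.lie_mem h₃ h₁
  obtain i | i := i <;> fin_cases i
  · exact h₁
  · exact h₂
  · exact h₃
  · exact h4
  · exact h5
  · exact h6
  · exact K.lie_mem h₁ h4
  · exact K.lie_mem h₂ h4
  · exact K.lie_mem h₂ h5
  · exact K.lie_mem h₃ h5
  · exact K.lie_mem h₃ h6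
  · exact K.lie_mem h₁ h6
  · exact K.smul_mem _ (K.sub_mem (K.lie_mem h4 h₃) (K.lie_mem h₂ h6))
  · exact K.smul_mem _ (K.add_mem (K.lie_mem h4 h₃) (K.lie_mem h₂ h6))

/-- A nondegenerate Serre system of type `G₂` gives a pairwise bracket-generating triple. -/
theorem pairwiseGenerates (s : IsSerreG₂ e₁ e₂ f₁ f₂ h₁ h₂)
    (li : LinearIndependent ℝ (chevalleyBasis e₁ e₂ f₁ f₂ h₁ h₂)) :
    BracketG2.PairwiseGenerates e₁ ⁅e₁, e₂⁆ ((1 / 2 : ℝ) • ⁅f₁, ⁅f₁, f₂⁆⁆) := by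
  set S₃ := (1 / 2 : ℝ) • ⁅f₁, ⁅f₁, f₂⁆⁆ with hS₃
  set v := Sum.elim (BracketG2.rootVector e₁ ⁅e₁, e₂⁆ S₃) (BracketG2.cartanVector e₁ ⁅e₁, e₂⁆ S₃)
    with hv
  have hle₁ : Submodule.span ℝ (range (chevalleyBasis e₁ e₂ f₁ f₂ h₁ h₂)) ≤
      Submodule.span ℝ (range v) := by
    rw [Submodule.span_le]
    rintro _ ⟨i, rfl⟩
    exact s.chevalleyBasis_mem_span i
  have hle₂ : Submodule.span ℝ (range v) ≤
      (LieSubalgebra.lieSpan ℝ 𝔏 {e₁, ⁅e₁, e₂⁆, S₃}).toSubmodule := by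
    rw [Submodule.span_le]
    rintro _ ⟨i, rfl⟩
    exact rootVector_mem (LieSubalgebra.subset_lieSpan (by simp))
      (LieSubalgebra.subset_lieSpan (by simp)) (LieSubalgebra.subset_lieSpan (by simp)) i
  have hle₃ : LieSubalgebra.lieSpan ℝ 𝔏 {e₁, ⁅e₁, e₂⁆, S₃} ≤
      LieSubalgebra.lieSpan ℝ 𝔏 {e₁, e₂, f₁, f₂} := by
    have he₁ : e₁ ∈ LieSubalgebra.lieSpan ℝ 𝔏 {e₁, e₂, f₁, f₂} :=
      LieSubalgebra.subset_lieSpan (by simp)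
    have he₂ : e₂ ∈ LieSubalgebra.lieSpan ℝ 𝔏 {e₁, e₂, f₁, f₂} :=
      LieSubalgebra.subset_lieSpan (by simp)
    have hf₁ : f₁ ∈ LieSubalgebra.lieSpan ℝ 𝔏 {e₁, e₂, f₁, f₂} :=
      LieSubalgebra.subset_lieSpan (by simp)
    have hf₂ : f₂ ∈ LieSubalgebra.lieSpan ℝ 𝔏 {e₁, e₂, f₁, f₂} :=
      LieSubalgebra.subset_lieSpan (by simp)
    rw [LieSubalgebra.lieSpan_le]
    rintro _ (rfl | rfl | rfl)
    · exact he₁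
    · exact LieSubalgebra.lie_mem _ he₁ he₂
    · exact LieSubalgebra.smul_mem _ _
        (LieSubalgebra.lie_mem _ hf₁ (LieSubalgebra.lie_mem _ hf₁ hf₂))
  have hle₄ := s.lieSpan_le_span_chevalleyBasis
  -- The inclusions close into a cycle: span of the 14 elements ≤ algebra generated by the triple ≤
  -- algebra generated by the Chevalley generators ≤ span of the Chevalley basis ≤ span of the 14
  -- elements. All four are equal.
  have hspan : Submodule.span ℝ (range v) =
      (LieSubalgebra.lieSpan ℝ 𝔏 {e₁, ⁅e₁, e₂⁆, S₃}).toSubmodule :=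
    le_antisymm hle₂ (le_trans hle₃ (hle₄.trans hle₁))
  have hspan' : Submodule.span ℝ (range v) =
      Submodule.span ℝ (range (chevalleyBasis e₁ e₂ f₁ f₂ h₁ h₂)) :=
    le_antisymm (hle₂.trans (le_trans hle₃ hle₄)) hle₁
  have hgen : LieSubalgebra.lieSpan ℝ 𝔏 {e₁, ⁅e₁, e₂⁆, S₃} =
      LieSubalgebra.lieSpan ℝ 𝔏 {e₁, e₂, f₁, f₂} :=
    le_antisymm hle₃ (hle₄.trans (hle₁.trans hle₂))
  -- Fourteen vectors with the same span as fourteen independent vectors are independent.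
  have hli : LinearIndependent ℝ v := by
    rw [linearIndependent_iff_card_eq_finrank_span, Set.finrank, hspan']
    rw [linearIndependent_iff_card_eq_finrank_span, Set.finrank] at li
    rw [← li]
    rfl
  have hroot (i) : ⁅BracketG2.cartanVector e₁ ⁅e₁, e₂⁆ S₃ 0,
        BracketG2.rootVector e₁ ⁅e₁, e₂⁆ S₃ i⁆ =
        (BracketG2.rootPosition i).1 • BracketG2.rootVector e₁ ⁅e₁, e₂⁆ S₃ i ∧
      ⁅BracketG2.cartanVector e₁ ⁅e₁, e₂⁆ S₃ 1, BracketG2.rootVector e₁ ⁅e₁, e₂⁆ S₃ i⁆ =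
        (BracketG2.rootPosition i).2 • BracketG2.rootVector e₁ ⁅e₁, e₂⁆ S₃ i := by
    rw [hS₃, s.cartanVector_eq]
    exact s.root_eq i
  refine ⟨hli, hspan, ?_, ?_, hroot⟩
  · rw [hgen]
    exact s.nonempty_equiv_g₂ li
  · refine exists_isCartanSubalgebra_of_roots hli hspan
      (α := fun j i => ![(BracketG2.rootPosition i).1, (BracketG2.rootPosition i).2] j) ?_ ?_ ?_
    · intro j i
      fin_cases j
      exacts [(hroot i).1, (hroot i).2]
    · have h21 : ⁅h₂, h₁⁆ = 0 := by rw [← lie_skew, s.h₁_h₂, neg_zero]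
      intro j j'
      rw [hS₃, s.cartanVector_eq]
      fin_cases j <;> fin_cases j' <;> simp [s.h₁_h₂, h21]
    · intro i
      have : (BracketG2.rootPosition i).1 ≠ 0 ∨ (BracketG2.rootPosition i).2 ≠ 0 := by
        fin_cases i <;> norm_num [BracketG2.rootPosition]
      obtain h | h := this
      exacts [⟨0, h⟩, ⟨1, h⟩]

end IsSerreG₂

noncomputable section

/-! ### The polynomial vector fields preserving the flat Cartan distribution -/

set_option linter.unusedSimpArgs false
set_option linter.unreachableTactic false
set_option linter.unusedTactic false
set_option linter.unnecessarySeqFocus false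

namespace FlatCartan

open MvPolynomial

/-- Polynomial vector fields on `ℝ⁵`. -/
abbrev PolyField : Type :=
  Derivation ℝ (MvPolynomial (Fin 5) ℝ) (MvPolynomial (Fin 5) ℝ)

/-- The polynomial vector field with the given components. -/
def polyField (v : Fin 5 → MvPolynomial (Fin 5) ℝ) : PolyField := mkDerivation ℝ v

theorem polyField_X (v : Fin 5 → MvPolynomial (Fin 5) ℝ) (i : Fin 5) : polyField v (X i) = v i :=
  mkDerivation_X ℝ v i

theorem ext_components {D D' : PolyField} (h : ∀ i, D (X i) = D' (X i)) : D = D' :=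
  MvPolynomial.derivation_ext h

/-- Polynomial identities over the infinite field ℝ may be checked pointwise, which turns each
bracket relation below into an identity between real numbers. -/
theorem ext_eval {D D' : PolyField} (h : ∀ i x, eval x (D (X i)) = eval x (D' (X i))) :
    D = D' :=
  ext_components fun i => MvPolynomial.funext (h i)

/-- The polynomial vector field `e₁`. -/
def e₁ : PolyField :=
  polyField ![C 8 * X 2 + C 4 * X 3 * X 4,
    0,
    C (-4) * X 4,
    C (-8),
    0]

/-- The polynomial vector field `e₂`. -/
def e₂ : PolyField :=
  polyField ![C (1 / 192) * X 3 ^ 3,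
    C (-1 / 32) * X 0 + C (-1 / 64) * X 3 ^ 2 * X 4,
    0,
    0,
    C (-1 / 32) * X 3]

/-- The polynomial vector field `e₁₂`. -/
def e₁₂ : PolyField :=
  polyField ![0,
    C (-1 / 4) * X 2 + C (1 / 8) * X 3 * X 4,
    C (-1 / 8) * X 3,
    0,
    C (1 / 4)]

/-- The polynomial vector field `e₁₁₂`. -/
def e₁₁₂ : PolyField :=
  polyField ![0,
    0,
    C 2,
    0,
    0]

/-- The polynomial vector field `e₁₁₁₂`. -/
def e₁₁₁₂ : PolyField :=
  polyField ![C (-16),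
    0,
    0,
    0,
    0]

/-- The polynomial vector field `e₂₁₁₁₂`. -/
def e₂₁₁₁₂ : PolyField :=
  polyField ![0,
    C (-1 / 2),
    0,
    0,
    0]

/-- The polynomial vector field `f₁`. -/
def f₁ : PolyField :=
  polyField ![C (-1 / 16) * X 3 ^ 3 * X 4,
    C (1 / 4) * X 2 ^ 2 + C (-1 / 4) * X 2 * X 3 * X 4 + C (1 / 16) * X 3 ^ 2 * X 4 ^ 2,
    C (3 / 8) * X 0 + C (1 / 4) * X 2 * X 3 + C (1 / 16) * X 3 ^ 2 * X 4,
    C (1 / 8) * X 3 ^ 2,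
    C (-1 / 2) * X 2 + C (1 / 8) * X 3 * X 4]

/-- The polynomial vector field `f₂`. -/
def f₂ : PolyField :=
  polyField ![C (-32) * X 1 + C 16 * X 3 * X 4 ^ 2,
    C (-16 / 3) * X 4 ^ 3,
    0,
    C (-32) * X 4,
    0]

/-- The polynomial vector field `f₁₂`. -/
def f₁₂ : PolyField :=
  polyField ![C (-8) * X 2 ^ 2 + C (-8) * X 2 * X 3 * X 4 + C (-2) * X 3 ^ 2 * X 4 ^ 2,
    C 2 * X 3 * X 4 ^ 3,
    C 12 * X 1 + C 8 * X 2 * X 4 + C (-2) * X 3 * X 4 ^ 2,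
    C 16 * X 2 + C 4 * X 3 * X 4,
    C 4 * X 4 ^ 2]

/-- The polynomial vector field `f₁₁₂`. -/
def f₁₁₂ : PolyField :=
  polyField ![C (-6) * X 0 * X 2 + C (-3) * X 0 * X 3 * X 4 + C (-1 / 2) * X 3 ^ 3 * X 4 ^ 2,
    C (-6) * X 1 * X 2 + C 3 * X 1 * X 3 * X 4 + C (-1 / 2) * X 3 ^ 2 * X 4 ^ 3,
    C 3 * X 0 * X 4 + C (-3) * X 1 * X 3 + C (-2) * X 2 ^ 2 + X 3 ^ 2 * X 4 ^ 2,
    C 6 * X 0 + C (-2) * X 2 * X 3 + X 3 ^ 2 * X 4,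
    C 6 * X 1 + C (-2) * X 2 * X 4 + C (-1) * X 3 * X 4 ^ 2]

/-- The polynomial vector field `f₁₁₁₂`. -/
def f₁₁₁₂ : PolyField :=
  polyField ![C (-9 / 4) * X 0 ^ 2 + C (3 / 8) * X 1 * X 3 ^ 3 + C (3 / 8) * X 2 * X 3 ^ 3 * X 4,
    C (-9 / 4) * X 0 * X 1 + C (-9 / 8) * X 1 * X 3 ^ 2 * X 4 + C (-1 / 2) * X 2 ^ 3 + C (3 / 4)
      * X 2 ^ 2 * X 3 * X 4 + C (-3 / 8) * X 2 * X 3 ^ 2 * X 4 ^ 2 + C (1 / 8) * X 3 ^ 3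
      * X 4 ^ 3,
    C (-9 / 4) * X 0 * X 2 + C (-3 / 4) * X 2 ^ 2 * X 3 + C (-3 / 8) * X 2 * X 3 ^ 2 * X 4,
    C (-9 / 4) * X 0 * X 3 + C (-3 / 4) * X 2 * X 3 ^ 2 + C (-3 / 8) * X 3 ^ 3 * X 4,
    C (-9 / 4) * X 1 * X 3 + C (3 / 2) * X 2 ^ 2 + C (-3 / 4) * X 2 * X 3 * X 4 + C (3 / 8)
      * X 3 ^ 2 * X 4 ^ 2]

/-- The polynomial vector field `f₂₁₁₁₂`. -/
def f₂₁₁₁₂ : PolyField :=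
  polyField ![C 72 * X 0 * X 1 + C (-36) * X 0 * X 3 * X 4 ^ 2 + C (-16) * X 2 ^ 3
      + C (-24) * X 2 ^ 2 * X 3 * X 4 + C (-12) * X 2 * X 3 ^ 2 * X 4 ^ 2 + C (-4) * X 3 ^ 3 * X 4 ^ 3,
    C 12 * X 0 * X 4 ^ 3 + C 72 * X 1 ^ 2 + C 12 * X 2 * X 3 * X 4 ^ 3,
    C 72 * X 1 * X 2 + C 24 * X 2 ^ 2 * X 4 + C (-12) * X 2 * X 3 * X 4 ^ 2,
    C 72 * X 0 * X 4 + C 48 * X 2 ^ 2 + C 24 * X 2 * X 3 * X 4 + C 12 * X 3 ^ 2 * X 4 ^ 2,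
    C 72 * X 1 * X 4 + C 24 * X 2 * X 4 ^ 2 + C (-12) * X 3 * X 4 ^ 3]

/-- The polynomial vector field `h₁`. -/
def h₁ : PolyField :=
  polyField ![C (-3) * X 0,
    0,
    C (-1) * X 2,
    C (-2) * X 3,
    X 4]

/-- The polynomial vector field `h₂`. -/
def h₂ : PolyField :=
  polyField ![X 0,
    C (-1) * X 1,
    0,
    X 3,
    C (-1) * X 4]

theorem lie_h₁_h₂ : ⁅h₁, h₂⁆ = 0 := by
  refine ext_eval fun i x => ?_
  fin_cases i <;>
    simp [Derivation.commutator_apply, Derivation.leibniz_pow, polyField_X, h₁, h₂] <;> ring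

theorem lie_e₁_f₁ : ⁅e₁, f₁⁆ = h₁ := by
  refine ext_eval fun i x => ?_
  fin_cases i <;>
    simp [Derivation.commutator_apply, Derivation.leibniz_pow, polyField_X, e₁, f₁, h₁] <;> ring

theorem lie_e₂_f₂ : ⁅e₂, f₂⁆ = h₂ := by
  refine ext_eval fun i x => ?_
  fin_cases i <;>
    simp [Derivation.commutator_apply, Derivation.leibniz_pow, polyField_X, e₂, f₂, h₂] <;> ring

theorem lie_e₁_f₂ : ⁅e₁, f₂⁆ = 0 := by
  refine ext_eval fun i x => ?_
  fin_cases i <;>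
    simp [Derivation.commutator_apply, Derivation.leibniz_pow, polyField_X, e₁, f₂] <;> ring

theorem lie_e₂_f₁ : ⁅e₂, f₁⁆ = 0 := by
  refine ext_eval fun i x => ?_
  fin_cases i <;>
    simp [Derivation.commutator_apply, Derivation.leibniz_pow, polyField_X, e₂, f₁] <;> ring

theorem lie_h₁_e₁ : ⁅h₁, e₁⁆ = (2 : ℝ) • e₁ := by
  refine ext_eval fun i x => ?_
  fin_cases i <;>
    simp [Derivation.commutator_apply, Derivation.leibniz_pow, polyField_X, h₁, e₁] <;> ring

theorem lie_h₁_e₂ : ⁅h₁, e₂⁆ = (-3 : ℝ) • e₂ := by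
  refine ext_eval fun i x => ?_
  fin_cases i <;>
    simp [Derivation.commutator_apply, Derivation.leibniz_pow, polyField_X, h₁, e₂] <;> ring

theorem lie_h₂_e₁ : ⁅h₂, e₁⁆ = (-1 : ℝ) • e₁ := by
  refine ext_eval fun i x => ?_
  fin_cases i <;>
    simp [Derivation.commutator_apply, Derivation.leibniz_pow, polyField_X, h₂, e₁] <;> ring

theorem lie_h₂_e₂ : ⁅h₂, e₂⁆ = (2 : ℝ) • e₂ := by
  refine ext_eval fun i x => ?_
  fin_cases i <;>
    simp [Derivation.commutator_apply, Derivation.leibniz_pow, polyField_X, h₂, e₂] <;> ring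

theorem lie_h₁_f₁ : ⁅h₁, f₁⁆ = (-2 : ℝ) • f₁ := by
  refine ext_eval fun i x => ?_
  fin_cases i <;>
    simp [Derivation.commutator_apply, Derivation.leibniz_pow, polyField_X, h₁, f₁] <;> ring

theorem lie_h₁_f₂ : ⁅h₁, f₂⁆ = (3 : ℝ) • f₂ := by
  refine ext_eval fun i x => ?_
  fin_cases i <;>
    simp [Derivation.commutator_apply, Derivation.leibniz_pow, polyField_X, h₁, f₂] <;> ring

theorem lie_h₂_f₁ : ⁅h₂, f₁⁆ = (1 : ℝ) • f₁ := by
  refine ext_eval fun i x => ?_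
  fin_cases i <;>
    simp [Derivation.commutator_apply, Derivation.leibniz_pow, polyField_X, h₂, f₁] <;> ring

theorem lie_h₂_f₂ : ⁅h₂, f₂⁆ = (-2 : ℝ) • f₂ := by
  refine ext_eval fun i x => ?_
  fin_cases i <;>
    simp [Derivation.commutator_apply, Derivation.leibniz_pow, polyField_X, h₂, f₂] <;> ring

theorem lie_e₁_e₂ : ⁅e₁, e₂⁆ = e₁₂ := by
  refine ext_eval fun i x => ?_
  fin_cases i <;>
    simp [Derivation.commutator_apply, Derivation.leibniz_pow, polyField_X, e₁, e₂, e₁₂] <;> ring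

theorem lie_e₁_e₁₂ : ⁅e₁, e₁₂⁆ = e₁₁₂ := by
  refine ext_eval fun i x => ?_
  fin_cases i <;>
    simp [Derivation.commutator_apply, Derivation.leibniz_pow, polyField_X, e₁, e₁₂, e₁₁₂] <;> ring

theorem lie_e₁_e₁₁₂ : ⁅e₁, e₁₁₂⁆ = e₁₁₁₂ := by
  refine ext_eval fun i x => ?_
  fin_cases i <;>
    simp [Derivation.commutator_apply, Derivation.leibniz_pow, polyField_X, e₁, e₁₁₂, e₁₁₁₂] <;> ring

theorem lie_e₁_e₁₁₁₂ : ⁅e₁, e₁₁₁₂⁆ = 0 := by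
  refine ext_eval fun i x => ?_
  fin_cases i <;>
    simp [Derivation.commutator_apply, Derivation.leibniz_pow, polyField_X, e₁, e₁₁₁₂] <;> ring

theorem lie_e₂_e₁₂ : ⁅e₂, e₁₂⁆ = 0 := by
  refine ext_eval fun i x => ?_
  fin_cases i <;>
    simp [Derivation.commutator_apply, Derivation.leibniz_pow, polyField_X, e₂, e₁₂] <;> ring

theorem lie_e₂_e₁₁₁₂ : ⁅e₂, e₁₁₁₂⁆ = e₂₁₁₁₂ := by
  refine ext_eval fun i x => ?_
  fin_cases i <;>
    simp [Derivation.commutator_apply, Derivation.leibniz_pow, polyField_X, e₂, e₁₁₁₂, e₂₁₁₁₂] <;> ring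

theorem lie_f₁_f₂ : ⁅f₁, f₂⁆ = f₁₂ := by
  refine ext_eval fun i x => ?_
  fin_cases i <;>
    simp [Derivation.commutator_apply, Derivation.leibniz_pow, polyField_X, f₁, f₂, f₁₂] <;> ring

theorem lie_f₁_f₁₂ : ⁅f₁, f₁₂⁆ = f₁₁₂ := by
  refine ext_eval fun i x => ?_
  fin_cases i <;>
    simp [Derivation.commutator_apply, Derivation.leibniz_pow, polyField_X, f₁, f₁₂, f₁₁₂] <;> ring

theorem lie_f₁_f₁₁₂ : ⁅f₁, f₁₁₂⁆ = f₁₁₁₂ := by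
  refine ext_eval fun i x => ?_
  fin_cases i <;>
    simp [Derivation.commutator_apply, Derivation.leibniz_pow, polyField_X, f₁, f₁₁₂, f₁₁₁₂] <;> ring

theorem lie_f₁_f₁₁₁₂ : ⁅f₁, f₁₁₁₂⁆ = 0 := by
  refine ext_eval fun i x => ?_
  fin_cases i <;>
    simp [Derivation.commutator_apply, Derivation.leibniz_pow, polyField_X, f₁, f₁₁₁₂] <;> ring

theorem lie_f₂_f₁₂ : ⁅f₂, f₁₂⁆ = 0 := by
  refine ext_eval fun i x => ?_
  fin_cases i <;>
    simp [Derivation.commutator_apply, Derivation.leibniz_pow, polyField_X, f₂, f₁₂] <;> ring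

theorem lie_f₂_f₁₁₁₂ : ⁅f₂, f₁₁₁₂⁆ = f₂₁₁₁₂ := by
  refine ext_eval fun i x => ?_
  fin_cases i <;>
    simp [Derivation.commutator_apply, Derivation.leibniz_pow, polyField_X, f₂, f₁₁₁₂, f₂₁₁₁₂] <;> ring

theorem isSerreG₂ : IsSerreG₂ e₁ e₂ f₁ f₂ h₁ h₂ where
  h₁_h₂ := lie_h₁_h₂
  e₁_f₁ := lie_e₁_f₁
  e₂_f₂ := lie_e₂_f₂
  e₁_f₂ := lie_e₁_f₂
  e₂_f₁ := lie_e₂_f₁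
  h₁_e₁ := lie_h₁_e₁
  h₁_e₂ := lie_h₁_e₂
  h₂_e₁ := lie_h₂_e₁
  h₂_e₂ := lie_h₂_e₂
  h₁_f₁ := lie_h₁_f₁
  h₁_f₂ := lie_h₁_f₂
  h₂_f₁ := lie_h₂_f₁
  h₂_f₂ := lie_h₂_f₂
  ad_e₁ := by rw [lie_e₁_e₂, lie_e₁_e₁₂, lie_e₁_e₁₁₂, lie_e₁_e₁₁₁₂]
  ad_e₂ := by rw [← lie_skew e₂ e₁, lie_neg, lie_e₁_e₂, lie_e₂_e₁₂, neg_zero]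
  ad_f₁ := by rw [lie_f₁_f₂, lie_f₁_f₁₂, lie_f₁_f₁₁₂, lie_f₁_f₁₁₁₂]
  ad_f₂ := by rw [← lie_skew f₂ f₁, lie_neg, lie_f₁_f₂, lie_f₂_f₁₂, neg_zero]

end FlatCartan

end

namespace FlatCartan

open MvPolynomial IsSerreG₂

theorem chevalleyBasis_eq : chevalleyBasis e₁ e₂ f₁ f₂ h₁ h₂ =
    Sum.elim (Sum.elim ![e₁, e₂, e₁₂, e₁₁₂, e₁₁₁₂, e₂₁₁₁₂] ![f₁, f₂, f₁₂, f₁₁₂, f₁₁₁₂, f₂₁₁₁₂])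
      ![h₁, h₂] := by
  simp only [chevalleyBasis, halfBasis, lie_e₁_e₂, lie_e₁_e₁₂, lie_e₁_e₁₁₂, lie_e₂_e₁₁₁₂,
    lie_f₁_f₂, lie_f₁_f₁₂, lie_f₁_f₁₁₂, lie_f₂_f₁₁₁₂]

/-- At the origin only e₁, e₁₂, e₁₁₂, e₁₁₁₂, e₂₁₁₁₂ are nonzero, and they point along the five axes.
The other nine fields vanish there and are separated by nine values of their ∂_{a₄} and ∂_{a₅}
components. -/
theorem linearIndependent_chevalleyBasis :
    LinearIndependent ℝ (chevalleyBasis e₁ e₂ f₁ f₂ h₁ h₂) := by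
  rw [chevalleyBasis_eq, Fintype.linearIndependent_iff]
  intro c hc
  have ev (i : Fin 5) (x : Fin 5 → ℝ) := congrArg (fun D : PolyField => eval x (D (X i))) hc
  simp only [Fintype.sum_sum_type, Fin.sum_univ_six, Fin.sum_univ_two, Sum.elim_inl,
    Sum.elim_inr] at ev
  simp [Derivation.add_apply, Derivation.smul_apply, e₁, e₂, e₁₂, e₁₁₂, e₁₁₁₂, e₂₁₁₁₂, f₁, f₂, f₁₂,
    f₁₁₂, f₁₁₁₂, f₂₁₁₁₂, h₁, h₂, polyField_X] at ev
  have a0 := ev 0 0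
  have a1 := ev 1 0
  have a2 := ev 2 0
  have a3 := ev 3 0
  have a4 := ev 4 0
  have b1 := ev 3 ![0, 0, 0, 1, 0]
  have b2 := ev 3 ![0, 0, 0, -1, 0]
  have b3 := ev 4 ![0, 0, 0, 1, 0]
  have b4 := ev 4 ![0, 0, 0, 0, 1]
  have b5 := ev 4 ![0, 0, 0, 0, -1]
  have b6 := ev 3 ![0, 0, 0, 0, 1]
  have b7 := ev 3 ![1, 0, 0, 0, 0]
  have b8 := ev 3 ![0, 0, 1, 0, 0]
  have b9 := ev 4 ![0, 0, 1, 0, 0]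
  simp at a0 a1 a2 a3 a4 b1 b2 b3 b4 b5 b6 b7 b8 b9
  rintro ((i | i) | i) <;> fin_cases i <;> simp <;> linarith

end FlatCartan

noncomputable section

/-! ### Pulling back polynomial vector fields along local diffeomorphisms -/

namespace IsSerreG₂

variable {𝔏 𝔏' : Type*} [LieRing 𝔏] [LieAlgebra ℝ 𝔏] [LieRing 𝔏'] [LieAlgebra ℝ 𝔏']
  {e₁ e₂ f₁ f₂ h₁ h₂ : 𝔏}

theorem map (s : IsSerreG₂ e₁ e₂ f₁ f₂ h₁ h₂) (φ : 𝔏 →ₗ⁅ℝ⁆ 𝔏') :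
    IsSerreG₂ (φ e₁) (φ e₂) (φ f₁) (φ f₂) (φ h₁) (φ h₂) where
  h₁_h₂ := by rw [← LieHom.map_lie, s.h₁_h₂, map_zero]
  e₁_f₁ := by rw [← LieHom.map_lie, s.e₁_f₁]
  e₂_f₂ := by rw [← LieHom.map_lie, s.e₂_f₂]
  e₁_f₂ := by rw [← LieHom.map_lie, s.e₁_f₂, map_zero]
  e₂_f₁ := by rw [← LieHom.map_lie, s.e₂_f₁, map_zero]
  h₁_e₁ := by rw [← LieHom.map_lie, s.h₁_e₁, map_smul]
  h₁_e₂ := by rw [← LieHom.map_lie, s.h₁_e₂, map_smul]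
  h₂_e₁ := by rw [← LieHom.map_lie, s.h₂_e₁, map_smul]
  h₂_e₂ := by rw [← LieHom.map_lie, s.h₂_e₂, map_smul]
  h₁_f₁ := by rw [← LieHom.map_lie, s.h₁_f₁, map_smul]
  h₁_f₂ := by rw [← LieHom.map_lie, s.h₁_f₂, map_smul]
  h₂_f₁ := by rw [← LieHom.map_lie, s.h₂_f₁, map_smul]
  h₂_f₂ := by rw [← LieHom.map_lie, s.h₂_f₂, map_smul]
  ad_e₁ := by simp only [← LieHom.map_lie, s.ad_e₁, map_zero]
  ad_e₂ := by simp only [← LieHom.map_lie, s.ad_e₂, map_zero]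
  ad_f₁ := by simp only [← LieHom.map_lie, s.ad_f₁, map_zero]
  ad_f₂ := by simp only [← LieHom.map_lie, s.ad_f₂, map_zero]

end IsSerreG₂

namespace FlatCartan

open MvPolynomial

theorem contDiff_eval (p : MvPolynomial (Fin 5) ℝ) :
    ContDiff ℝ ∞ fun a : Fin 5 → ℝ => eval a p := by
  induction p using MvPolynomial.induction_on with
  | C r => simpa using contDiff_const
  | add p q hp hq => simpa using hp.add hq
  | mul_X p i hp => simpa using hp.mul (contDiff_apply ℝ ℝ i)

/-- The vector field on `ℝ⁵` given by a polynomial vector field. -/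
def evalField (D : PolyField) (a : Fin 5 → ℝ) : Fin 5 → ℝ := fun i => eval a (D (X i))

theorem contDiff_evalField (D : PolyField) : ContDiff ℝ ∞ (evalField D) :=
  contDiff_pi.mpr fun i => contDiff_eval (D (X i))

theorem differentiableAt_evalField (D : PolyField) (a : Fin 5 → ℝ) :
    DifferentiableAt ℝ (evalField D) a :=
  (contDiff_evalField D).contDiffAt.differentiableAt (by simp)

theorem differentiableAt_eval (p : MvPolynomial (Fin 5) ℝ) (a : Fin 5 → ℝ) :
    DifferentiableAt ℝ (fun a : Fin 5 → ℝ => eval a p) a :=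
  (contDiff_eval p).contDiffAt.differentiableAt (by simp)

/-- Both sides satisfy the Leibniz rule in p, so it suffices that they agree on constants and
coordinates. This links the formal derivation with the directional derivative, and so the commutator
with the bracket DW·V - DV·W. -/
theorem fderiv_eval_evalField (D : PolyField) (a : Fin 5 → ℝ) (p : MvPolynomial (Fin 5) ℝ) :
    fderiv ℝ (fun a : Fin 5 → ℝ => eval a p) a (evalField D a) = eval a (D p) := by
  induction p using MvPolynomial.induction_on with
  | C r => simp
  | add p q hp hq =>
    simp only [map_add]
    rw [fderiv_fun_add (differentiableAt_eval p a) (differentiableAt_eval q a),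
      _root_.add_apply, hp, hq]
  | mul_X p i hp =>
    have hX : HasFDerivAt (fun a : Fin 5 → ℝ => eval a (X i : MvPolynomial (Fin 5) ℝ))
        (ContinuousLinearMap.proj i : (Fin 5 → ℝ) →L[ℝ] ℝ) a := by
      simpa using hasFDerivAt_apply i a
    simp only [map_mul]
    rw [fderiv_fun_mul (differentiableAt_eval p a) hX.differentiableAt, hX.fderiv]
    simp [hp, evalField, Derivation.leibniz]

theorem evalField_lie (D D' : PolyField) (a : Fin 5 → ℝ) :
    evalField ⁅D, D'⁆ a = VectorField.lieBracket ℝ (evalField D) (evalField D') a := by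
  funext i
  have key (D D' : PolyField) :
      fderiv ℝ (evalField D') a (evalField D a) i = eval a (D (D' (X i))) := by
    rw [← fderiv_eval_evalField]
    exact congrArg (fun L : (Fin 5 → ℝ) →L[ℝ] ℝ => L (evalField D a))
      (fderiv_apply (differentiableAt_evalField D' a) i).symm
  rw [VectorField.lieBracket_eq]
  simp only [Pi.sub_apply, key]
  simp [evalField, Derivation.commutator_apply]

variable {U : Opens (Fin 5 → ℝ)} {φ : (Fin 5 → ℝ) → Fin 5 → ℝ}

theorem contDiffOn_pullback (hφ : ContDiffOn ℝ ∞ φ U) (hinv : ∀ x ∈ U, (fderiv ℝ φ x).IsInvertible)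
    (D : PolyField) : ContDiffOn ℝ ∞ (VectorField.pullback ℝ φ (evalField D)) U := by
  intro x hx
  have h1 : ContDiffAt ℝ ∞ φ x := hφ.contDiffAt (U.isOpen.mem_nhds hx)
  have h2 : ContDiffAt ℝ ∞ (fun y => (fderiv ℝ φ y).inverse) x :=
    (ContinuousLinearMap.IsInvertible.contDiffAt_map_inverse (hinv x hx)).comp x
      (h1.fderiv_right (m := ∞) (by simp))
  have h3 : ContDiffAt ℝ ∞ (fun y => evalField D (φ y)) x :=
    (contDiff_evalField D).contDiffAt.comp x h1
  exact (h2.clm_apply h3).contDiffWithinAt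

/-- The pullback of polynomial vector fields along a local diffeomorphism. -/
def pullbackHom (hφ : ContDiffOn ℝ ∞ φ U) (hinv : ∀ x ∈ U, (fderiv ℝ φ x).IsInvertible) :
    PolyField →ₗ⁅ℝ⁆ SmoothField U where
  toFun D := SmoothField.ofContDiffOn _ (contDiffOn_pullback hφ hinv D)
  map_add' D D' := SmoothField.ext_on fun x hx => by
    simp only [SmoothField.ofContDiffOn, Submodule.coe_add, Pi.add_apply,
      indicator_of_mem (SetLike.mem_coe.mpr hx), VectorField.pullback]
    rw [← map_add]
    congr 1
    funext i
    simp [evalField]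
  map_smul' c D := SmoothField.ext_on fun x hx => by
    simp only [SmoothField.ofContDiffOn, Submodule.coe_smul, Pi.smul_apply,
      indicator_of_mem (SetLike.mem_coe.mpr hx), VectorField.pullback, RingHom.id_apply]
    rw [← map_smul]
    congr 1
    funext i
    simp [evalField]
  map_lie' {D D'} := SmoothField.ext_on fun x hx => by
    have hnhds : (U : Set (Fin 5 → ℝ)) ∈ nhds x := U.isOpen.mem_nhds hx
    have heq (D : PolyField) : (U : Set (Fin 5 → ℝ)).indicator
        (VectorField.pullback ℝ φ (evalField D)) =ᶠ[nhds x]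
          VectorField.pullback ℝ φ (evalField D) :=
      Filter.eventually_of_mem hnhds fun y hy => indicator_of_mem hy _
    rw [SmoothField.coe_bracket]
    simp only [SmoothField.ofContDiffOn]
    rw [indicator_of_mem (SetLike.mem_coe.mpr hx), (heq D).lieBracket_vectorField_eq (heq D'),
      ← VectorField.pullback_lieBracket (n := ∞) (by
        simpa using
          (by exact_mod_cast le_top : ((2 : ℕ∞) : WithTop ℕ∞) ≤ ((⊤ : ℕ∞) : WithTop ℕ∞)))
        (hφ.contDiffAt hnhds)
        (differentiableAt_evalField D _) (differentiableAt_evalField D' _)]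
    simp only [VectorField.pullback, evalField_lie]

theorem pullbackHom_eq (hφ : ContDiffOn ℝ ∞ φ U) (hinv : ∀ x ∈ U, (fderiv ℝ φ x).IsInvertible)
    {D : PolyField} {V : (Fin 5 → ℝ) → Fin 5 → ℝ} (hV : ContDiffOn ℝ ∞ V U)
    (h : ∀ x ∈ U, fderiv ℝ φ x (V x) = evalField D (φ x)) :
    pullbackHom hφ hinv D = SmoothField.ofContDiffOn V hV :=
  SmoothField.ext_on fun x hx => by
    simp only [pullbackHom, SmoothField.ofContDiffOn, LieHom.coe_mk,
      indicator_of_mem (SetLike.mem_coe.mpr hx), VectorField.pullback]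
    rw [← h x hx, (hinv x hx).inverse_apply_self]

theorem eq_zero_of_eval_eq_zero {p : MvPolynomial (Fin 5) ℝ} {a : Fin 5 → ℝ}
    (h : ∀ᶠ b in nhds a, eval b p = 0) : p = 0 := by
  obtain ⟨ε, hε, hball⟩ := Metric.eventually_nhds_iff.mp h
  refine funext_set (fun i => Metric.ball (a i) ε) (fun i => ?_) fun x hx => ?_
  · exact Metric.isOpen_ball.mem_nhds (Metric.mem_ball_self hε) |> infinite_of_mem_nhds (a i)
  · rw [map_zero]
    exact hball ((dist_pi_lt_iff hε).mpr fun i => hx i (mem_univ i))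

/-- φ is open near a point of U, so a field that pulls back to zero has polynomial components
vanishing on an open set. -/
theorem pullbackHom_injective (hφ : ContDiffOn ℝ ∞ φ U)
    (hinv : ∀ x ∈ U, (fderiv ℝ φ x).IsInvertible) (hU : (U : Set (Fin 5 → ℝ)).Nonempty) :
    Function.Injective (pullbackHom hφ hinv) := by
  rw [injective_iff_map_eq_zero]
  intro D hD
  obtain ⟨x, hx⟩ := hU
  have hnhds : (U : Set (Fin 5 → ℝ)) ∈ nhds x := U.isOpen.mem_nhds hx
  obtain ⟨L, hL⟩ := hinv x hx
  have hs : HasStrictFDerivAt φ (L : (Fin 5 → ℝ) →L[ℝ] (Fin 5 → ℝ)) x := by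
    rw [hL]
    exact (hφ.contDiffAt hnhds).hasStrictFDerivAt (by simp)
  have hzero (y) (hy : y ∈ U) : evalField D (φ y) = 0 := by
    have h := congrFun (congrArg Subtype.val hD) y
    simp only [pullbackHom, SmoothField.ofContDiffOn, LieHom.coe_mk,
      indicator_of_mem (SetLike.mem_coe.mpr hy), VectorField.pullback] at h
    exact (hinv y hy).inverse.injective (h.trans (map_zero _).symm)
  refine ext_components fun i => eq_zero_of_eval_eq_zero (a := φ x) ?_
  rw [← hs.map_nhds_eq_of_equiv, Filter.eventually_map]
  exact Filter.eventually_of_mem hnhds fun y hy => congrFun (hzero y hy) i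

/-- Vector fields that a local diffeomorphism relates to the polynomial model generate split
`𝔤₂`. -/
theorem pairwiseGenerates_of_related (hφ : ContDiffOn ℝ ∞ φ U)
    (hinv : ∀ x ∈ U, (fderiv ℝ φ x).IsInvertible) (hU : (U : Set (Fin 5 → ℝ)).Nonempty)
    {V₁ V₂ V₃ : (Fin 5 → ℝ) → Fin 5 → ℝ} (hV₁ : ContDiffOn ℝ ∞ V₁ U) (hV₂ : ContDiffOn ℝ ∞ V₂ U)
    (hV₃ : ContDiffOn ℝ ∞ V₃ U)
    (r₁ : ∀ x ∈ U, fderiv ℝ φ x (V₁ x) = evalField e₁ (φ x))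
    (r₂ : ∀ x ∈ U, fderiv ℝ φ x (V₂ x) = evalField e₁₂ (φ x))
    (r₃ : ∀ x ∈ U, fderiv ℝ φ x (V₃ x) = (1 / 2 : ℝ) • evalField f₁₁₂ (φ x)) :
    BracketG2.PairwiseGenerates (SmoothField.ofContDiffOn V₁ hV₁)
      (SmoothField.ofContDiffOn V₂ hV₂) (SmoothField.ofContDiffOn V₃ hV₃) := by
  have h3 : pullbackHom hφ hinv ((1 / 2 : ℝ) • f₁₁₂) = SmoothField.ofContDiffOn V₃ hV₃ := by
    refine pullbackHom_eq hφ hinv hV₃ fun x hx => (r₃ x hx).trans ?_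
    funext i
    simp [evalField]
  -- The triple is rewritten as the image of e₁, [e₁, e₂], ½[f₁, [f₁, f₂]], the form required by
  -- `pairwiseGenerates`.
  rw [← pullbackHom_eq hφ hinv hV₁ r₁, ← pullbackHom_eq hφ hinv hV₂ r₂, ← h3, map_smul,
    ← lie_f₁_f₁₂, ← lie_f₁_f₂, ← lie_e₁_e₂, LieHom.map_lie, LieHom.map_lie, LieHom.map_lie]
  refine (isSerreG₂.map _).pairwiseGenerates ?_
  have h := linearIndependent_chevalleyBasis.map' (pullbackHom hφ hinv).toLinearMap
    (LinearMap.ker_eq_bot.mpr (pullbackHom_injective hφ hinv hU))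
  have he : (pullbackHom hφ hinv).toLinearMap ∘ IsSerreG₂.chevalleyBasis e₁ e₂ f₁ f₂ h₁ h₂ = _ :=
    funext (IsSerreG₂.map_chevalleyBasis (pullbackHom hφ hinv) e₁ e₂ f₁ f₂ h₁ h₂)
  rwa [he] at h

end FlatCartan

end

noncomputable section

/-! ### Regularity of solutions and the derivatives of the coefficient functions -/

section Bootstrap

variable {E : Type*} [NormedAddCommGroup E] [NormedSpace ℝ E]

/-- Solutions of a smooth autonomous differential equation are smooth. -/
theorem contDiffOn_of_hasDerivAt_comp {I : Set ℝ} (hI : IsOpen I) {u : ℝ → E} {g : E → E}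
    (hg : ContDiff ℝ ∞ g) (hu : ∀ x ∈ I, HasDerivAt u (g (u x)) x) : ContDiffOn ℝ ∞ u I := by
  rw [contDiffOn_infty]
  intro n
  induction n with
  | zero => exact contDiffOn_zero.mpr fun x hx => (hu x hx).continuousAt.continuousWithinAt
  | succ n ih =>
    rw [Nat.cast_add, Nat.cast_one, contDiffOn_succ_iff_deriv_of_isOpen hI]
    refine ⟨fun x hx => (hu x hx).differentiableAt.differentiableWithinAt, by simp, ?_⟩
    exact ((hg.of_le (by exact_mod_cast le_top)).comp_contDiffOn ih).congr
      fun x hx => (hu x hx).deriv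

theorem contDiffOn_of_hasDerivAt {I : Set ℝ} (hI : IsOpen I) {u u' : ℝ → E}
    (hu' : ContDiffOn ℝ ∞ u' I) (hu : ∀ x ∈ I, HasDerivAt u (u' x) x) : ContDiffOn ℝ ∞ u I := by
  rw [contDiffOn_infty_iff_deriv_of_isOpen hI]
  exact ⟨fun x hx => (hu x hx).differentiableAt.differentiableWithinAt,
    hu'.congr fun x hx => (hu x hx).deriv⟩

end Bootstrap

namespace Chazy

/-- The hypotheses on the coefficient functions at a point, as a first order system. -/
structure CoeffSystem (P F ρ χ : ℝ → ℝ) (I : Opens ℝ) : Prop where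
  ne : ∀ x ∈ I, ρ x ≠ 0
  hP : ∀ x ∈ I, HasDerivAt P ((P x ^ 2 - Q P x) / 6) x
  hQ : ∀ x ∈ I, HasDerivAt (Q P) (2 / 3 * (P x * Q P x - R P x)) x
  hR : ∀ x ∈ I, HasDerivAt (R P) (P x * R P x + Q P x ^ 2 / 15) x
  hρ : ∀ x ∈ I, HasDerivAt ρ (ξ ρ x * ρ x) x
  hξ : ∀ x ∈ I, HasDerivAt (ξ ρ) (Chazy.Q P x / 45 - ξ ρ x ^ 2) x
  hF : ∀ x ∈ I, HasDerivAt F (P x) x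
  hχ : ∀ x ∈ I, HasDerivAt χ (1 / ρ x ^ 2) x

theorem hasDerivAt_deriv_of_contDiffOn {n : ℕ} {f : ℝ → ℝ} {I : Opens ℝ}
    (hf : ContDiffOn ℝ (n + 1) f I) :
    (∀ x ∈ I, HasDerivAt f (deriv f x) x) ∧ ContDiffOn ℝ n (deriv f) I := by
  have h := (contDiffOn_succ_iff_deriv_of_isOpen I.isOpen).mp hf
  exact ⟨fun x hx => ((h.1 x hx).differentiableAt (I.isOpen.mem_nhds hx)).hasDerivAt, h.2.2⟩

variable {P F ρ χ : ℝ → ℝ} {I : Opens ℝ}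

/-- The Chazy equation becomes a first-order system of Ramanujan type for (P, Q, R). The equations
for P' and Q' only unfold definitions, and R' carries the Chazy equation. The linear equation for ρ
becomes a Riccati equation for ξ. -/
theorem coeffSystem (hP : IsSolution (3 / 2) P I) (hF : ∀ x ∈ I, HasDerivAt F (P x) x)
    (hρ : ContDiffOn ℝ 2 ρ I) (hρ_ne : ∀ x ∈ I, ρ x ≠ 0)
    (hρ_eq : ∀ x ∈ I, iteratedDeriv 2 ρ x - 1 / 45 * Q P x * ρ x = 0)
    (hχ : ∀ x ∈ I, HasDerivAt χ (1 / (ρ x) ^ 2) x) : CoeffSystem P F ρ χ I := by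
  obtain ⟨hP3, hPeq⟩ := hP
  obtain ⟨hP0, hc1⟩ := hasDerivAt_deriv_of_contDiffOn (n := 2) (f := P) (by exact_mod_cast hP3)
  obtain ⟨hP1, hc2⟩ := hasDerivAt_deriv_of_contDiffOn (n := 1) (f := deriv P)
    (by exact_mod_cast hc1)
  obtain ⟨hP2, -⟩ := hasDerivAt_deriv_of_contDiffOn (n := 0) (f := deriv (deriv P))
    (by exact_mod_cast hc2)
  obtain ⟨hρ0, hd1⟩ := hasDerivAt_deriv_of_contDiffOn (n := 1) (f := ρ) (by exact_mod_cast hρ)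
  obtain ⟨hρ1, -⟩ := hasDerivAt_deriv_of_contDiffOn (n := 0) (f := deriv ρ)
    (by exact_mod_cast hd1)
  have hQ (x) (hx : x ∈ I) : HasDerivAt (Q P) (2 * P x * deriv P x - 6 * deriv (deriv P) x) x := by
    refine (((hP0 x hx).pow 2).sub ((hP1 x hx).const_mul 6)).congr_deriv ?_
    ring
  have hQ' (x) (hx : x ∈ I) : HasDerivAt (deriv (Q P)) (2 * (deriv P x) ^ 2 +
      2 * P x * deriv (deriv P) x - 6 * deriv (deriv (deriv P)) x) x := by
    have h : HasDerivAt (fun x => 2 * P x * deriv P x - 6 * deriv (deriv P) x)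
        (2 * (deriv P x) ^ 2 +
        2 * P x * deriv (deriv P) x - 6 * deriv (deriv (deriv P)) x) x := by
      refine ((((hP0 x hx).const_mul 2).mul (hP1 x hx)).sub ((hP2 x hx).const_mul 6)).congr_deriv ?_
      ring
    refine h.congr_of_eventuallyEq ?_
    exact Filter.eventually_of_mem (I.isOpen.mem_nhds hx) fun y hy => (hQ y hy).deriv
  have hR (x) (hx : x ∈ I) := ((hP0 x hx).mul (hQ x hx)).sub ((hQ' x hx).const_mul (3 / 2))
  have eR (x) (hx : x ∈ I) : R P x = P x * Q P x - 3 / 2 * (2 * P x * deriv P x -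
      6 * deriv (deriv P) x) := by
    rw [R, (hQ x hx).deriv]
  refine ⟨hρ_ne, fun x hx => ?_, fun x hx => ?_, fun x hx => ?_, fun x hx => ?_, fun x hx => ?_,
    hF, hχ⟩
  · refine (hP0 x hx).congr_deriv ?_
    rw [Q]; ring
  · refine (hQ x hx).congr_deriv ?_
    rw [eR x hx]; ring
  · refine (hR x hx).congr_deriv ?_
    have h := hPeq x hx
    simp only [iteratedDeriv_succ, iteratedDeriv_zero] at h
    rw [eR x hx, Q]
    -- R = PQ - 3PP' + 9P'', so P''' enters R' with coefficient 9. For k = 3/2 the constant 4/(36 -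
    -- k²) is 16/135.
    linear_combination (9 : ℝ) * h
  · refine (hρ0 x hx).congr_deriv ?_
    rw [ξ, div_mul_cancel₀ _ (hρ_ne x hx)]
  · refine ((hρ1 x hx).div (hρ0 x hx) (hρ_ne x hx)).congr_deriv ?_
    have h := hρ_eq x hx
    simp only [iteratedDeriv_succ, iteratedDeriv_zero] at h
    have h0 := hρ_ne x hx
    rw [sub_eq_zero.mp h, ξ]
    field_simp

/-- The coefficient functions are smooth. -/
structure SmoothCoeff (P F ρ χ : ℝ → ℝ) (I : Opens ℝ) : Prop where
  hP : ContDiffOn ℝ ∞ P I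
  hQ : ContDiffOn ℝ ∞ (Q P) I
  hR : ContDiffOn ℝ ∞ (R P) I
  hρ : ContDiffOn ℝ ∞ ρ I
  hξ : ContDiffOn ℝ ∞ (ξ ρ) I
  hF : ContDiffOn ℝ ∞ F I
  hχ : ContDiffOn ℝ ∞ χ I

/-- (P, Q, R, ρ, ξ) solves an autonomous polynomial system, so its regularity bootstraps. F and χ
are then primitives of smooth functions. -/
theorem CoeffSystem.smooth (s : CoeffSystem P F ρ χ I) : SmoothCoeff P F ρ χ I := by
  have h : ContDiffOn ℝ ∞ (fun x => (P x, Chazy.Q P x, Chazy.R P x, ρ x, Chazy.ξ ρ x)) I := by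
    refine contDiffOn_of_hasDerivAt_comp I.isOpen
      (g := fun u : ℝ × ℝ × ℝ × ℝ × ℝ => ((u.1 ^ 2 - u.2.1) / 6,
        2 / 3 * (u.1 * u.2.1 - u.2.2.1), u.1 * u.2.2.1 + u.2.1 ^ 2 / 15,
        u.2.2.2.2 * u.2.2.2.1, u.2.1 / 45 - u.2.2.2.2 ^ 2)) (by fun_prop) fun x hx => ?_
    exact (s.hP x hx).prodMk ((s.hQ x hx).prodMk ((s.hR x hx).prodMk
      ((s.hρ x hx).prodMk (s.hξ x hx))))
  have hP := h.fst
  have hρ := h.snd.snd.snd.fst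
  exact ⟨hP, h.snd.fst, h.snd.snd.fst, hρ, h.snd.snd.snd.snd,
    contDiffOn_of_hasDerivAt I.isOpen hP s.hF,
    contDiffOn_of_hasDerivAt I.isOpen
      (contDiffOn_const.div (hρ.pow 2) fun x hx => pow_ne_zero 2 (s.ne x hx)) s.hχ⟩

end Chazy

end

noncomputable section

/-! ### The flattening map and its derivative -/

namespace Chazy

section Coefficients

variable (P F ρ : ℝ → ℝ) (x : ℝ)

/-- The coefficient of `y` in `G`. -/
def coeffG : ℝ := 3 * ξ ρ x + P x / 3

/-- The coefficient of `y` in `B`. -/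
def coeffB₀ : ℝ := 9 * ξ ρ x ^ 2 + 2 * P x * ξ ρ x - (Q P x / 60 - P x ^ 2 / 12)

/-- The coefficient of `p` in `B`. -/
def coeffB₁ : ℝ := -6 * ξ ρ x - P x

/-- The coefficient of `p²` in `K`. -/
def coeffK₀ : ℝ := -4 * (6 * ξ ρ x + P x)

/-- The coefficient of `yp` in `K`. -/
def coeffK₁ : ℝ := 2 * (36 * ξ ρ x ^ 2 + 8 * P x * ξ ρ x - 1 / 15 * Q P x + 1 / 3 * P x ^ 2)

/-- The coefficient of `y²` in `K`. -/
def coeffK₂ : ℝ :=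
  -(72 * ξ ρ x ^ 3 + 24 * P x * ξ ρ x ^ 2 + 8 / 3 * P x ^ 2 * ξ ρ x
    + 1 / 9 * (P x ^ 3 + 1 / 5 * P x * Q P x + 2 / 5 * R P x))

/-- The factor `J / B`. -/
def weightJ : ℝ := 2 / 3 * ρ x * Real.exp (-(1 / 3) * F x)

/-- The weight of `G` in `c₃`. -/
def weightG : ℝ := 1 / ρ x * Real.exp (-(1 / 3) * F x)

/-- The weight of `y` in the first flat coordinate. -/
def weightY : ℝ := -(1 / ρ x ^ 3 * Real.exp (-(1 / 3) * F x))

end Coefficients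

variable {P F ρ χ : ℝ → ℝ} {I : Opens ℝ} {x : ℝ}

namespace CoeffSystem

theorem hasDerivAt_exp (s : CoeffSystem P F ρ χ I) (hx : x ∈ I) (c : ℝ) :
    HasDerivAt (fun x => Real.exp (c * F x)) (c * P x * Real.exp (c * F x)) x :=
  (((s.hF x hx).const_mul c).exp).congr_deriv (by ring)

theorem hasDerivAt_coeffG (s : CoeffSystem P F ρ χ I) (hx : x ∈ I) :
    HasDerivAt (coeffG P ρ) (3 * (Q P x / 45 - ξ ρ x ^ 2) + (P x ^ 2 - Q P x) / 18) x :=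
  (((s.hξ x hx).const_mul 3).add ((s.hP x hx).div_const 3)).congr_deriv (by ring)

theorem hasDerivAt_coeffB₀ (s : CoeffSystem P F ρ χ I) (hx : x ∈ I) :
    HasDerivAt (coeffB₀ P ρ) (18 * ξ ρ x * (Q P x / 45 - ξ ρ x ^ 2)
      + (P x ^ 2 - Q P x) / 3 * ξ ρ x + 2 * P x * (Q P x / 45 - ξ ρ x ^ 2)
      - (P x * Q P x - R P x) / 90 + P x * (P x ^ 2 - Q P x) / 36) x := by
  refine (((((s.hξ x hx).pow 2).const_mul 9).add
    (((s.hP x hx).const_mul 2).mul (s.hξ x hx))).sub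
    (((s.hQ x hx).div_const 60).sub (((s.hP x hx).pow 2).div_const 12))).congr_deriv ?_
  ring

theorem hasDerivAt_coeffB₁ (s : CoeffSystem P F ρ χ I) (hx : x ∈ I) :
    HasDerivAt (coeffB₁ P ρ) (-6 * (Q P x / 45 - ξ ρ x ^ 2) - (P x ^ 2 - Q P x) / 6) x :=
  (((s.hξ x hx).const_mul (-6)).sub (s.hP x hx)).congr_deriv (by ring)

theorem hasDerivAt_coeffK₀ (s : CoeffSystem P F ρ χ I) (hx : x ∈ I) :
    HasDerivAt (coeffK₀ P ρ)
      (-4 * (6 * (Q P x / 45 - ξ ρ x ^ 2) + (P x ^ 2 - Q P x) / 6)) x :=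
  ((((s.hξ x hx).const_mul 6).add (s.hP x hx)).const_mul (-4)).congr_deriv (by ring)

theorem hasDerivAt_coeffK₁ (s : CoeffSystem P F ρ χ I) (hx : x ∈ I) :
    HasDerivAt (coeffK₁ P ρ) (2 * (72 * ξ ρ x * (Q P x / 45 - ξ ρ x ^ 2)
      + 8 * ((P x ^ 2 - Q P x) / 6) * ξ ρ x + 8 * P x * (Q P x / 45 - ξ ρ x ^ 2)
      - 2 / 45 * (P x * Q P x - R P x) + 1 / 9 * P x * (P x ^ 2 - Q P x))) x := by
  refine (((((((s.hξ x hx).pow 2).const_mul 36).add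
    (((s.hP x hx).const_mul 8).mul (s.hξ x hx))).sub ((s.hQ x hx).const_mul (1 / 15))).add
    (((s.hP x hx).pow 2).const_mul (1 / 3))).const_mul 2).congr_deriv ?_
  ring

theorem hasDerivAt_coeffK₂ (s : CoeffSystem P F ρ χ I) (hx : x ∈ I) :
    HasDerivAt (coeffK₂ P ρ) (-((216 * ξ ρ x ^ 2 + 48 * P x * ξ ρ x + 8 / 3 * P x ^ 2)
        * (Q P x / 45 - ξ ρ x ^ 2)
      + (24 * ξ ρ x ^ 2 + 16 / 3 * P x * ξ ρ x + 1 / 3 * P x ^ 2 + 1 / 45 * Q P x)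
        * ((P x ^ 2 - Q P x) / 6)
      + 1 / 45 * P x * (2 / 3 * (P x * Q P x - R P x))
      + 2 / 45 * (P x * R P x + Q P x ^ 2 / 15))) x := by
  refine ((((((s.hξ x hx).pow 3).const_mul 72).add
    (((s.hP x hx).const_mul 24).mul ((s.hξ x hx).pow 2))).add
    ((((s.hP x hx).pow 2).const_mul (8 / 3)).mul (s.hξ x hx))).add
    (((((s.hP x hx).pow 3).add (((s.hP x hx).const_mul (1 / 5)).mul (s.hQ x hx))).add
      ((s.hR x hx).const_mul (2 / 5))).const_mul (1 / 9))).neg.congr_deriv ?_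
  simp only [Pi.pow_apply]
  ring

theorem hasDerivAt_weightJ (s : CoeffSystem P F ρ χ I) (hx : x ∈ I) :
    HasDerivAt (weightJ F ρ) (weightJ F ρ x * (ξ ρ x - P x / 3)) x := by
  refine (((s.hρ x hx).const_mul (2 / 3)).mul (s.hasDerivAt_exp hx (-(1 / 3)))).congr_deriv ?_
  rw [weightJ]
  ring

theorem hasDerivAt_weightG (s : CoeffSystem P F ρ χ I) (hx : x ∈ I) :
    HasDerivAt (weightG F ρ) (weightG F ρ x * (-ξ ρ x - P x / 3)) x := by
  have h := s.ne x hx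
  refine (((hasDerivAt_const x 1).div (s.hρ x hx) h).mul
    (s.hasDerivAt_exp hx (-(1 / 3)))).congr_deriv ?_
  rw [weightG]
  simp only [Pi.div_apply]
  field_simp
  ring

theorem hasDerivAt_weightY (s : CoeffSystem P F ρ χ I) (hx : x ∈ I) :
    HasDerivAt (weightY F ρ) (weightY F ρ x * (-3 * ξ ρ x - P x / 3)) x := by
  have h := s.ne x hx
  refine (((hasDerivAt_const x 1).div ((s.hρ x hx).pow 3) (pow_ne_zero 3 h)).mul
    (s.hasDerivAt_exp hx (-(1 / 3)))).neg.congr_deriv ?_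
  rw [weightY]
  simp only [Pi.div_apply, Pi.pow_apply]
  field_simp
  ring

end CoeffSystem

section FlatMap

variable (P F ρ χ : ℝ → ℝ) (m : Fin 5 → ℝ)

/-- The quadratic part of `c₂`. -/
def K : ℝ :=
  coeffK₀ P ρ (m 0) * m 3 ^ 2 + coeffK₁ P ρ (m 0) * m 1 * m 3 + coeffK₂ P ρ (m 0) * m 1 ^ 2

/-- The map to `ℝ⁵` that carries the Monge distribution to the flat Cartan distribution. -/
def flatMap : Fin 5 → ℝ :=
  ![weightY F ρ (m 0) * m 1,
    1 / 2 * m 2 + 1 / 2 * χ (m 0) * J P F ρ m ^ 2 + J P F ρ m * (weightG F ρ (m 0) * G P ρ m)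
      + 1 / 12 * (Real.exp (-(2 / 3) * F (m 0)) * K P ρ m),
    c₃ P F ρ χ m, χ (m 0), J P F ρ m]

theorem B_eq : B P ρ m = coeffB₀ P ρ (m 0) * m 1 + coeffB₁ P ρ (m 0) * m 3 + 3 / 2 * m 4 := by
  rw [B, coeffB₀, coeffB₁]; ring

theorem G_eq : G P ρ m = coeffG P ρ (m 0) * m 1 - m 3 := by
  rw [G, coeffG]; ring

theorem J_eq : J P F ρ m = weightJ F ρ (m 0) * B P ρ m := by
  rw [J, weightJ]

theorem c₃_eq : c₃ P F ρ χ m = -(χ (m 0) / 2 * J P F ρ m) - weightG F ρ (m 0) * G P ρ m := by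
  rw [c₃, weightG]; ring

/-- Here and in `c₂_eq` the coefficients of S³ become polynomials in the flat coordinates, the very
ones that appear in `evalField_f₁₁₂`. -/
theorem c₁_eq (h : ρ (m 0) ≠ 0) : c₁ P F ρ χ m =
    3 / 8 * flatMap P F ρ χ m 0 - 1 / 8 * flatMap P F ρ χ m 2 * flatMap P F ρ χ m 3
      + 1 / 16 * flatMap P F ρ χ m 3 ^ 2 * flatMap P F ρ χ m 4 := by
  simp only [flatMap, Fin.isValue, Matrix.cons_val]
  rw [c₁, c₃, weightY]
  field_simp
  ring

theorem c₂_eq : c₂ P F ρ χ m =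
    12 * flatMap P F ρ χ m 1 - 4 * flatMap P F ρ χ m 2 * flatMap P F ρ χ m 4
      - 2 * flatMap P F ρ χ m 3 * flatMap P F ρ χ m 4 ^ 2 := by
  simp only [flatMap, Fin.isValue, Matrix.cons_val]
  rw [c₂, c₃, K, coeffK₀, coeffK₁, coeffK₂, weightG]
  ring

end FlatMap

section LineDerivative

variable {m v : Fin 5 → ℝ}

/-- The differential of `flatMap` is computed along lines t ↦ m + tv at t = 0, where one-variable
calculus suffices. -/
theorem hasDerivAt_line (m v : Fin 5 → ℝ) (i : Fin 5) :
    HasDerivAt (fun t : ℝ => (m + t • v) i) (v i) 0 := by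
  simpa using ((hasDerivAt_id (0 : ℝ)).mul_const (v i)).const_add (m i)

theorem hasDerivAt_comp_line {f : ℝ → ℝ} {f' : ℝ} (hf : HasDerivAt f f' (m 0)) :
    HasDerivAt (fun t : ℝ => f ((m + t • v) 0)) (f' * v 0) 0 :=
  HasDerivAt.comp (0 : ℝ) (h₂ := f) (h := fun t : ℝ => (m + t • v) 0) (by simpa using hf)
    (hasDerivAt_line m v 0)

variable (P F ρ m v) in
/-- The derivative of `G` in the direction `v`. -/
def dG : ℝ :=
  (3 * (Q P (m 0) / 45 - ξ ρ (m 0) ^ 2) + (P (m 0) ^ 2 - Q P (m 0)) / 18) * v 0 * m 1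
    + coeffG P ρ (m 0) * v 1 - v 3

variable (P ρ m v) in
/-- The derivative of `B` in the direction `v`. -/
def dB : ℝ :=
  (18 * ξ ρ (m 0) * (Q P (m 0) / 45 - ξ ρ (m 0) ^ 2)
      + (P (m 0) ^ 2 - Q P (m 0)) / 3 * ξ ρ (m 0) + 2 * P (m 0) * (Q P (m 0) / 45 - ξ ρ (m 0) ^ 2)
      - (P (m 0) * Q P (m 0) - R P (m 0)) / 90
      + P (m 0) * (P (m 0) ^ 2 - Q P (m 0)) / 36) * v 0 * m 1
    + coeffB₀ P ρ (m 0) * v 1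
    + (-6 * (Q P (m 0) / 45 - ξ ρ (m 0) ^ 2) - (P (m 0) ^ 2 - Q P (m 0)) / 6) * v 0 * m 3
    + coeffB₁ P ρ (m 0) * v 3 + 3 / 2 * v 4

variable (P ρ m v) in
/-- The derivative of `K` in the direction `v`. -/
def dK : ℝ :=
  -4 * (6 * (Q P (m 0) / 45 - ξ ρ (m 0) ^ 2) + (P (m 0) ^ 2 - Q P (m 0)) / 6) * v 0 * m 3 ^ 2
    + 2 * coeffK₀ P ρ (m 0) * m 3 * v 3
    + 2 * (72 * ξ ρ (m 0) * (Q P (m 0) / 45 - ξ ρ (m 0) ^ 2)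
      + 8 * ((P (m 0) ^ 2 - Q P (m 0)) / 6) * ξ ρ (m 0)
      + 8 * P (m 0) * (Q P (m 0) / 45 - ξ ρ (m 0) ^ 2)
      - 2 / 45 * (P (m 0) * Q P (m 0) - R P (m 0))
      + 1 / 9 * P (m 0) * (P (m 0) ^ 2 - Q P (m 0))) * v 0 * m 1 * m 3
    + coeffK₁ P ρ (m 0) * (v 1 * m 3 + m 1 * v 3)
    - ((216 * ξ ρ (m 0) ^ 2 + 48 * P (m 0) * ξ ρ (m 0) + 8 / 3 * P (m 0) ^ 2)
        * (Q P (m 0) / 45 - ξ ρ (m 0) ^ 2)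
      + (24 * ξ ρ (m 0) ^ 2 + 16 / 3 * P (m 0) * ξ ρ (m 0) + 1 / 3 * P (m 0) ^ 2
          + 1 / 45 * Q P (m 0)) * ((P (m 0) ^ 2 - Q P (m 0)) / 6)
      + 1 / 45 * P (m 0) * (2 / 3 * (P (m 0) * Q P (m 0) - R P (m 0)))
      + 2 / 45 * (P (m 0) * R P (m 0) + Q P (m 0) ^ 2 / 15)) * v 0 * m 1 ^ 2
    + 2 * coeffK₂ P ρ (m 0) * m 1 * v 1

variable (P F ρ m v) in
/-- The derivative of `J` in the direction `v`. -/
def dJ : ℝ :=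
  weightJ F ρ (m 0) * ((ξ ρ (m 0) - P (m 0) / 3) * v 0 * B P ρ m + dB P ρ m v)

variable (P F ρ m v) in
/-- The derivative of `weightG * G` in the direction `v`. -/
def dWeightedG : ℝ :=
  weightG F ρ (m 0) * ((-ξ ρ (m 0) - P (m 0) / 3) * v 0 * G P ρ m + dG P ρ m v)

variable (P F ρ χ m v) in
/-- The derivative of `flatMap` in the direction `v`. -/
def dFlatMap : Fin 5 → ℝ :=
  ![weightY F ρ (m 0) * ((-3 * ξ ρ (m 0) - P (m 0) / 3) * v 0 * m 1 + v 1),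
    1 / 2 * v 2 + 1 / 2 * (1 / ρ (m 0) ^ 2) * v 0 * J P F ρ m ^ 2
      + χ (m 0) * J P F ρ m * dJ P F ρ m v + dJ P F ρ m v * (weightG F ρ (m 0) * G P ρ m)
      + J P F ρ m * dWeightedG P F ρ m v
      + 1 / 12 * (Real.exp (-(2 / 3) * F (m 0))
        * (-(2 / 3) * P (m 0) * v 0 * K P ρ m + dK P ρ m v)),
    -(1 / 2 * (1 / ρ (m 0) ^ 2) * v 0 * J P F ρ m) - χ (m 0) / 2 * dJ P F ρ m v
      - dWeightedG P F ρ m v,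
    1 / ρ (m 0) ^ 2 * v 0, dJ P F ρ m v]

namespace CoeffSystem

variable (s : CoeffSystem P F ρ χ I) (hm : m 0 ∈ I)

include s hm

theorem hasDerivAt_B_line (v : Fin 5 → ℝ) :
    HasDerivAt (fun t : ℝ => B P ρ (m + t • v)) (dB P ρ m v) 0 := by
  simp only [B_eq]
  refine ((((hasDerivAt_comp_line (v := v) (s.hasDerivAt_coeffB₀ hm)).mul
    (hasDerivAt_line m v 1)).add ((hasDerivAt_comp_line (s.hasDerivAt_coeffB₁ hm)).mul
    (hasDerivAt_line m v 3))).add ((hasDerivAt_line m v 4).const_mul (3 / 2))).congr_deriv ?_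
  simp only [zero_smul, add_zero, dB]
  ring

theorem hasDerivAt_G_line (v : Fin 5 → ℝ) :
    HasDerivAt (fun t : ℝ => G P ρ (m + t • v)) (dG P ρ m v) 0 := by
  simp only [G_eq]
  refine (((hasDerivAt_comp_line (v := v) (s.hasDerivAt_coeffG hm)).mul
    (hasDerivAt_line m v 1)).sub (hasDerivAt_line m v 3)).congr_deriv ?_
  simp only [zero_smul, add_zero, dG]

theorem hasDerivAt_K_line (v : Fin 5 → ℝ) :
    HasDerivAt (fun t : ℝ => K P ρ (m + t • v)) (dK P ρ m v) 0 := by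
  refine ((((hasDerivAt_comp_line (v := v) (s.hasDerivAt_coeffK₀ hm)).mul
    ((hasDerivAt_line m v 3).pow 2)).add
    (((hasDerivAt_comp_line (v := v) (s.hasDerivAt_coeffK₁ hm)).mul
      (hasDerivAt_line m v 1)).mul (hasDerivAt_line m v 3))).add
    ((hasDerivAt_comp_line (v := v) (s.hasDerivAt_coeffK₂ hm)).mul
      ((hasDerivAt_line m v 1).pow 2))).congr_deriv ?_
  simp only [Pi.pow_apply, Pi.mul_apply, zero_smul, add_zero, dK]
  ring

theorem hasDerivAt_J_line (v : Fin 5 → ℝ) :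
    HasDerivAt (fun t : ℝ => J P F ρ (m + t • v)) (dJ P F ρ m v) 0 := by
  simp only [J_eq]
  refine ((hasDerivAt_comp_line (v := v) (s.hasDerivAt_weightJ hm)).mul
    (s.hasDerivAt_B_line hm v)).congr_deriv ?_
  simp only [zero_smul, add_zero, dJ]
  ring

theorem hasDerivAt_weightedG_line (v : Fin 5 → ℝ) :
    HasDerivAt (fun t : ℝ => weightG F ρ ((m + t • v) 0) * G P ρ (m + t • v))
      (dWeightedG P F ρ m v) 0 := by
  refine ((hasDerivAt_comp_line (v := v) (s.hasDerivAt_weightG hm)).mul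
    (s.hasDerivAt_G_line hm v)).congr_deriv ?_
  simp only [zero_smul, add_zero, dWeightedG]
  ring

theorem hasDerivAt_flatMap_line (v : Fin 5 → ℝ) :
    HasDerivAt (fun t : ℝ => flatMap P F ρ χ (m + t • v)) (dFlatMap P F ρ χ m v) 0 := by
  have hJ := s.hasDerivAt_J_line hm v
  have hG := s.hasDerivAt_weightedG_line hm v
  have hχ := hasDerivAt_comp_line (v := v) (s.hχ (m 0) hm)
  rw [hasDerivAt_pi]
  intro i
  fin_cases i
  · refine ((hasDerivAt_comp_line (v := v) (s.hasDerivAt_weightY hm)).mul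
      (hasDerivAt_line m v 1)).congr_deriv ?_
    simp only [zero_smul, add_zero, dFlatMap]
    simp
    ring
  · refine (((((hasDerivAt_line m v 2).const_mul (1 / 2)).add
      ((hχ.const_mul (1 / 2)).mul (hJ.pow 2))).add (hJ.mul hG)).add
      (((hasDerivAt_comp_line (v := v) (s.hasDerivAt_exp hm (-(2 / 3)))).mul
        (s.hasDerivAt_K_line hm v)).const_mul (1 / 12))).congr_deriv ?_
    simp only [zero_smul, add_zero, dFlatMap, Pi.pow_apply]
    simp
    ring
  · change HasDerivAt (fun t : ℝ => c₃ P F ρ χ (m + t • v)) _ 0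
    simp only [c₃_eq]
    refine (((hχ.div_const 2).mul hJ).neg.sub hG).congr_deriv ?_
    simp only [zero_smul, add_zero, dFlatMap]
    simp
    ring
  · exact hχ
  · exact hJ

end CoeffSystem

end LineDerivative

end Chazy

end

noncomputable section

/-! ### Smoothness of the vector fields and of the flattening map -/

namespace Chazy

variable {P F ρ χ : ℝ → ℝ} {I : Opens ℝ} {m : Fin 5 → ℝ}

theorem contDiffAt_comp_fst {f : ℝ → ℝ} (hf : ContDiffOn ℝ ∞ f I) (hm : m 0 ∈ I) :
    ContDiffAt ℝ ∞ (fun m : Fin 5 → ℝ => f (m 0)) m :=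
  ContDiffAt.comp m (g := f) (f := fun m : Fin 5 → ℝ => m 0)
    (hf.contDiffAt (I.isOpen.mem_nhds hm)) (contDiff_apply ℝ ℝ 0).contDiffAt

namespace SmoothCoeff

variable (s : SmoothCoeff P F ρ χ I) (hm : m 0 ∈ I) (h0 : ρ (m 0) ≠ 0)

include s hm

theorem contDiffAt_exp (c : ℝ) : ContDiffAt ℝ ∞ (fun m : Fin 5 → ℝ => Real.exp (c * F (m 0))) m :=
  (contDiffAt_const.mul (contDiffAt_comp_fst s.hF hm)).exp

theorem contDiffAt_G : ContDiffAt ℝ ∞ (G P ρ) m := by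
  have hP := s.hP.contDiffAt (I.isOpen.mem_nhds hm)
  have hξ := s.hξ.contDiffAt (I.isOpen.mem_nhds hm)
  unfold G
  generalize ξ ρ = ξ' at *
  fun_prop

theorem contDiffAt_B : ContDiffAt ℝ ∞ (B P ρ) m := by
  have hP := s.hP.contDiffAt (I.isOpen.mem_nhds hm)
  have hQ := s.hQ.contDiffAt (I.isOpen.mem_nhds hm)
  have hξ := s.hξ.contDiffAt (I.isOpen.mem_nhds hm)
  unfold B
  generalize ξ ρ = ξ' at *
  generalize Q P = Q' at *
  fun_prop

theorem contDiffAt_J : ContDiffAt ℝ ∞ (J P F ρ) m :=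
  (((contDiffAt_const.mul (contDiffAt_comp_fst s.hρ hm))).mul
    (s.contDiffAt_exp hm (-(1 / 3)))).mul (s.contDiffAt_B hm)

theorem contDiffAt_T : ContDiffAt ℝ ∞ (T P ρ) m := by
  have hP := s.hP.contDiffAt (I.isOpen.mem_nhds hm)
  have hQ := s.hQ.contDiffAt (I.isOpen.mem_nhds hm)
  have hR := s.hR.contDiffAt (I.isOpen.mem_nhds hm)
  have hξ := s.hξ.contDiffAt (I.isOpen.mem_nhds hm)
  unfold T
  generalize ξ ρ = ξ' at *
  generalize Q P = Q' at *
  generalize R P = R' at *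
  fun_prop

theorem contDiffAt_X₂ : ContDiffAt ℝ ∞ (X₂ F) m := by
  have hF := s.hF.contDiffAt (I.isOpen.mem_nhds hm)
  rw [contDiffAt_pi]
  intro i
  fin_cases i <;> simp [X₂] <;> fun_prop

theorem contDiffAt_X₃ : ContDiffAt ℝ ∞ (X₃ P F ρ χ) m := by
  have hP := s.hP.contDiffAt (I.isOpen.mem_nhds hm)
  have hQ := s.hQ.contDiffAt (I.isOpen.mem_nhds hm)
  have hR := s.hR.contDiffAt (I.isOpen.mem_nhds hm)
  have hρ := s.hρ.contDiffAt (I.isOpen.mem_nhds hm)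
  have hξ := s.hξ.contDiffAt (I.isOpen.mem_nhds hm)
  have hF := s.hF.contDiffAt (I.isOpen.mem_nhds hm)
  have hχ := s.hχ.contDiffAt (I.isOpen.mem_nhds hm)
  rw [contDiffAt_pi]
  unfold X₃
  generalize ξ ρ = ξ' at *
  generalize Q P = Q' at *
  generalize R P = R' at *
  intro i
  fin_cases i <;> simp only [Fin.zero_eta, Fin.mk_one, Fin.reduceFinMk, Matrix.cons_val] <;>
    fun_prop

include h0

theorem contDiffAt_c₁ : ContDiffAt ℝ ∞ (c₁ P F ρ χ) m := by
  have hρ := s.hρ.contDiffAt (I.isOpen.mem_nhds hm)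
  have hχ := s.hχ.contDiffAt (I.isOpen.mem_nhds hm)
  have he := s.contDiffAt_exp hm (-(1 / 3))
  have hJ := s.contDiffAt_J hm
  have hG := s.contDiffAt_G hm
  unfold c₁
  generalize J P F ρ = J' at *
  generalize G P ρ = G' at *
  fun_prop (disch := simp [h0])

theorem contDiffAt_c₃ : ContDiffAt ℝ ∞ (c₃ P F ρ χ) m := by
  have hρ := s.hρ.contDiffAt (I.isOpen.mem_nhds hm)
  have hχ := s.hχ.contDiffAt (I.isOpen.mem_nhds hm)
  have he := s.contDiffAt_exp hm (-(1 / 3))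
  have hJ := s.contDiffAt_J hm
  have hG := s.contDiffAt_G hm
  unfold c₃
  generalize J P F ρ = J' at *
  generalize G P ρ = G' at *
  fun_prop (disch := simp [h0])

theorem contDiffAt_c₂ : ContDiffAt ℝ ∞ (c₂ P F ρ χ) m := by
  have hP := s.hP.contDiffAt (I.isOpen.mem_nhds hm)
  have hQ := s.hQ.contDiffAt (I.isOpen.mem_nhds hm)
  have hR := s.hR.contDiffAt (I.isOpen.mem_nhds hm)
  have hρ := s.hρ.contDiffAt (I.isOpen.mem_nhds hm)
  have hξ := s.hξ.contDiffAt (I.isOpen.mem_nhds hm)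
  have hF := s.hF.contDiffAt (I.isOpen.mem_nhds hm)
  have hχ := s.hχ.contDiffAt (I.isOpen.mem_nhds hm)
  have hJ := s.contDiffAt_J hm
  have hG := s.contDiffAt_G hm
  unfold c₂
  generalize ξ ρ = ξ' at *
  generalize J P F ρ = J' at *
  generalize G P ρ = G' at *
  generalize Q P = Q' at *
  generalize R P = R' at *
  fun_prop (disch := simp [h0])

theorem contDiffAt_ell₃ : ContDiffAt ℝ ∞ (ell₃ P F ρ χ) m := by
  have hP := s.hP.contDiffAt (I.isOpen.mem_nhds hm)
  have hQ := s.hQ.contDiffAt (I.isOpen.mem_nhds hm)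
  have hρ := s.hρ.contDiffAt (I.isOpen.mem_nhds hm)
  have hξ := s.hξ.contDiffAt (I.isOpen.mem_nhds hm)
  have hF := s.hF.contDiffAt (I.isOpen.mem_nhds hm)
  have hχ := s.hχ.contDiffAt (I.isOpen.mem_nhds hm)
  have hT := s.contDiffAt_T hm
  have hc₁ := s.contDiffAt_c₁ hm h0
  have hc₂ := s.contDiffAt_c₂ hm h0
  have hc₃ := s.contDiffAt_c₃ hm h0
  unfold ell₃
  generalize ξ ρ = ξ' at *
  generalize Q P = Q' at *
  generalize T P ρ = T' at *
  generalize c₁ P F ρ χ = c₁' at *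
  generalize c₂ P F ρ χ = c₂' at *
  generalize c₃ P F ρ χ = c₃' at *
  fun_prop (disch := simp [h0])

omit h0 in
theorem contDiffAt_S₁ : ContDiffAt ℝ ∞ (S₁ P F ρ) m :=
  ((((contDiffAt_comp_fst s.hρ hm).pow 2).mul (s.contDiffAt_T hm)).neg.smul contDiffAt_const).sub
    ((contDiffAt_const.mul ((contDiffAt_comp_fst s.hρ hm).pow 2)).smul (s.contDiffAt_X₂ hm))

theorem contDiffAt_S₂ : ContDiffAt ℝ ∞ (S₂ F ρ) m :=
  ((s.contDiffAt_exp hm (1 / 3)).div (contDiffAt_const.mul (contDiffAt_comp_fst s.hρ hm))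
    (by simp [h0])).smul contDiffAt_const

theorem contDiffAt_S₃ : ContDiffAt ℝ ∞ (S₃ P F ρ χ) m := by
  have hP := s.hP.contDiffAt (I.isOpen.mem_nhds hm)
  have hρ := s.hρ.contDiffAt (I.isOpen.mem_nhds hm)
  have hξ := s.hξ.contDiffAt (I.isOpen.mem_nhds hm)
  have hF := s.hF.contDiffAt (I.isOpen.mem_nhds hm)
  have hχ := s.hχ.contDiffAt (I.isOpen.mem_nhds hm)
  have hB := s.contDiffAt_B hm
  have hG := s.contDiffAt_G hm
  have h₁ : ContDiffAt ℝ ∞ (fun m => ell₃ P F ρ χ m • X₁ m) m :=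
    (s.contDiffAt_ell₃ hm h0).smul contDiffAt_const
  have h₂ : ContDiffAt ℝ ∞ (fun m => 2 * Real.exp (-(1 / 3) * F (m 0)) / (3 * ρ (m 0)) *
      ((ρ (m 0)) ^ 4 * (χ (m 0)) ^ 2 * B P ρ m + 3 / 2 * (ρ (m 0)) ^ 2 * χ (m 0) * G P ρ m
        - 9 / 2 * m 1)) m := by
    generalize B P ρ = B' at *
    generalize G P ρ = G' at *
    fun_prop (disch := simp [h0])
  have h₃ : ContDiffAt ℝ ∞ (fun m => Real.exp (-(2 / 3) * F (m 0)) / (9 * (ρ (m 0)) ^ 2) *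
      ((ρ (m 0)) ^ 2 * χ (m 0) * B P ρ m + 9 * m 1 * ξ ρ (m 0) + P (m 0) * m 1
        - 3 * m 3) ^ 2) m := by
    generalize ξ ρ = ξ' at *
    generalize B P ρ = B' at *
    fun_prop (disch := simp [h0])
  exact (h₁.add (h₂.smul (s.contDiffAt_X₂ hm))).sub (h₃.smul (s.contDiffAt_X₃ hm))

theorem contDiffAt_flatMap : ContDiffAt ℝ ∞ (flatMap P F ρ χ) m := by
  have hP := s.hP.contDiffAt (I.isOpen.mem_nhds hm)
  have hQ := s.hQ.contDiffAt (I.isOpen.mem_nhds hm)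
  have hR := s.hR.contDiffAt (I.isOpen.mem_nhds hm)
  have hρ := s.hρ.contDiffAt (I.isOpen.mem_nhds hm)
  have hξ := s.hξ.contDiffAt (I.isOpen.mem_nhds hm)
  have hF := s.hF.contDiffAt (I.isOpen.mem_nhds hm)
  have hχ := s.hχ.contDiffAt (I.isOpen.mem_nhds hm)
  have hJ := s.contDiffAt_J hm
  have hG := s.contDiffAt_G hm
  rw [contDiffAt_pi]
  intro i
  fin_cases i
  · change ContDiffAt ℝ ∞ (fun m : Fin 5 → ℝ => weightY F ρ (m 0) * m 1) m
    unfold weightY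
    fun_prop (disch := simp [h0])
  · change ContDiffAt ℝ ∞ (fun m : Fin 5 → ℝ =>
      1 / 2 * m 2 + 1 / 2 * χ (m 0) * J P F ρ m ^ 2 + J P F ρ m * (weightG F ρ (m 0) * G P ρ m)
      + 1 / 12 * (Real.exp (-(2 / 3) * F (m 0)) * K P ρ m)) m
    unfold weightG K coeffK₀ coeffK₁ coeffK₂
    generalize ξ ρ = ξ' at *
    generalize J P F ρ = J' at *
    generalize G P ρ = G' at *
    generalize Q P = Q' at *
    generalize R P = R' at *
    fun_prop (disch := simp [h0])
  · exact s.contDiffAt_c₃ hm h0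
  · exact contDiffAt_comp_fst s.hχ hm
  · exact hJ

end SmoothCoeff

end Chazy

end

noncomputable section

/-! ### The vector fields in flat coordinates -/

namespace Chazy

variable {P F ρ χ : ℝ → ℝ} {I : Opens ℝ} {m : Fin 5 → ℝ}

theorem exp_third (t : ℝ) : Real.exp (1 / 3 * t) = (Real.exp (-(1 / 3) * t))⁻¹ := by
  rw [← Real.exp_neg]; ring_nf

theorem exp_neg_two_thirds (t : ℝ) : Real.exp (-(2 / 3) * t) = Real.exp (-(1 / 3) * t) ^ 2 := by
  rw [← Real.exp_nat_mul]; ring_nf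

variable (P F ρ χ m) in
/-- The vector field `Y` with `S³ = -c₁S¹ + c₂S² + c₃²Y`. -/
def Y : Fin 5 → ℝ :=
  (ρ (m 0) * Real.exp (1 / 3 * F (m 0)) / 6 *
      ((36 * (ξ ρ (m 0)) ^ 2 + 12 * P (m 0) * ξ ρ (m 0) + (P (m 0)) ^ 2 + Q P (m 0) / 15)
        * (ρ (m 0)) ^ 2 * χ (m 0) - 4 * P (m 0) - 24 * ξ ρ (m 0))) • X₁ m - X₃ P F ρ χ m

/-- The X²-coefficient of S³ is 8ρ²c₁, the X³-coefficient is -c₃², and ℓ₃ collects the three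
remaining multiples of X¹. The pushforward can then be taken term by term. -/
theorem S₃_eq (h : ρ (m 0) ≠ 0) : S₃ P F ρ χ m =
    -c₁ P F ρ χ m • S₁ P F ρ m + c₂ P F ρ χ m • S₂ F ρ m + c₃ P F ρ χ m ^ 2 • Y P F ρ χ m := by
  have he := Real.exp_ne_zero (-(1 / 3) * F (m 0))
  have h₁ : ell₃ P F ρ χ m = c₁ P F ρ χ m * ((ρ (m 0)) ^ 2 * T P ρ m)
      + c₂ P F ρ χ m * (Real.exp (1 / 3 * F (m 0)) / (4 * ρ (m 0)))
      + c₃ P F ρ χ m ^ 2 * (ρ (m 0) * Real.exp (1 / 3 * F (m 0)) / 6 *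
      ((36 * (ξ ρ (m 0)) ^ 2 + 12 * P (m 0) * ξ ρ (m 0) + (P (m 0)) ^ 2 + Q P (m 0) / 15)
        * (ρ (m 0)) ^ 2 * χ (m 0) - 4 * P (m 0) - 24 * ξ ρ (m 0))) := by
    rw [ell₃]
    ring
  have h₂ : 2 * Real.exp (-(1 / 3) * F (m 0)) / (3 * ρ (m 0)) *
        ((ρ (m 0)) ^ 4 * (χ (m 0)) ^ 2 * B P ρ m + 3 / 2 * (ρ (m 0)) ^ 2 * χ (m 0) * G P ρ m
          - 9 / 2 * m 1) = c₁ P F ρ χ m * (8 * (ρ (m 0)) ^ 2) := by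
    rw [c₁, J]
    field_simp
    ring
  have h₃ : Real.exp (-(2 / 3) * F (m 0)) / (9 * (ρ (m 0)) ^ 2) *
        ((ρ (m 0)) ^ 2 * χ (m 0) * B P ρ m + 9 * m 1 * ξ ρ (m 0) + P (m 0) * m 1 - 3 * m 3) ^ 2 =
      c₃ P F ρ χ m ^ 2 := by
    rw [c₃, J, G, exp_neg_two_thirds]
    field_simp
    ring
  simp only [S₃, h₁, h₂, h₃, S₁, S₂, Y]
  module

section Relations

variable (h : ρ (m 0) ≠ 0)

/-- T is chosen for this: the ∂_q component -ρ²T keeps J = w_χχ constant along S¹. -/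
theorem dJ_S₁ : dJ P F ρ m (S₁ P F ρ m) = 0 := by
  simp only [dJ, dB, S₁, X₁, X₂, Pi.sub_apply, Pi.smul_apply, smul_eq_mul, Matrix.cons_val]
  rw [T, B, coeffB₀, coeffB₁]
  ring

-- The weighted G is -w_χ, and S¹ moves χ at rate -8, so its derivative is 8w_χχ = 8J.
include h in
theorem dWeightedG_S₁ : dWeightedG P F ρ m (S₁ P F ρ m) = 8 * J P F ρ m := by
  simp only [dWeightedG, dG, S₁, X₁, X₂, Pi.sub_apply, Pi.smul_apply, smul_eq_mul, Matrix.cons_val]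
  rw [J, B, G, coeffG, weightG]
  field_simp
  ring

theorem dJ_S₂ (h : ρ (m 0) ≠ 0) : dJ P F ρ m (S₂ F ρ m) = 1 / 4 := by
  have he := Real.exp_ne_zero (-(1 / 3) * F (m 0))
  simp only [dJ, dB, S₂, X₁, Pi.smul_apply, smul_eq_mul, Matrix.cons_val]
  rw [weightJ, exp_third]
  field_simp
  ring

theorem dWeightedG_S₂ : dWeightedG P F ρ m (S₂ F ρ m) = 0 := by
  simp [dWeightedG, dG, S₂, X₁]

theorem dJ_Y : dJ P F ρ m (Y P F ρ χ m) = 0 := by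
  simp only [dJ, dB, Y, X₁, X₃, Pi.sub_apply, Pi.smul_apply, smul_eq_mul, Matrix.cons_val]
  rw [coeffB₀, coeffB₁]
  ring

theorem dWeightedG_Y (h : ρ (m 0) ≠ 0) : dWeightedG P F ρ m (Y P F ρ χ m) = 1 := by
  have he := Real.exp_ne_zero (-(1 / 3) * F (m 0))
  simp only [dWeightedG, dG, Y, X₁, X₃, Pi.sub_apply, Pi.smul_apply, smul_eq_mul, Matrix.cons_val]
  rw [coeffG, weightG, exp_third]
  field_simp
  ring

theorem dFlatMap_S₁ (h : ρ (m 0) ≠ 0) : dFlatMap P F ρ χ m (S₁ P F ρ m) =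
    FlatCartan.evalField FlatCartan.e₁ (flatMap P F ρ χ m) := by
  have he := Real.exp_ne_zero (-(1 / 3) * F (m 0))
  funext i
  fin_cases i
  · simp [dFlatMap, FlatCartan.evalField, FlatCartan.e₁, FlatCartan.polyField_X, flatMap]
    rw [c₃_eq]
    simp [S₁, X₁, X₂, weightY, weightG, G]
    field_simp
    ring
  -- The identity behind Z_χ = J². The Chazy equation is used here, through the value PR + Q²/15 of
  -- R' inside `dK`.
  · simp [dFlatMap, FlatCartan.evalField, FlatCartan.e₁, FlatCartan.polyField_X, flatMap]
    rw [dJ_S₁, dWeightedG_S₁ h, ← neg_mul, exp_neg_two_thirds]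
    simp only [S₁, X₁, X₂, K, dK, J, B, coeffK₀, coeffK₁, coeffK₂, Pi.sub_apply, Pi.smul_apply,
      smul_eq_mul, Matrix.cons_val]
    rw [exp_neg_two_thirds]
    field_simp
    ring
  · simp [dFlatMap, FlatCartan.evalField, FlatCartan.e₁, FlatCartan.polyField_X, flatMap]
    rw [dJ_S₁, dWeightedG_S₁ h]
    simp [S₁, X₁, X₂]
    field_simp
    ring
  · simp [dFlatMap, FlatCartan.evalField, FlatCartan.e₁, FlatCartan.polyField_X]
    simp [S₁, X₁, X₂]
    field_simp
  · simp [dFlatMap, FlatCartan.evalField, FlatCartan.e₁, FlatCartan.polyField_X, dJ_S₁]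

theorem dFlatMap_S₂ (h : ρ (m 0) ≠ 0) : dFlatMap P F ρ χ m (S₂ F ρ m) =
    FlatCartan.evalField FlatCartan.e₁₂ (flatMap P F ρ χ m) := by
  funext i
  fin_cases i <;>
    simp [dFlatMap, FlatCartan.evalField, FlatCartan.e₁₂, FlatCartan.polyField_X, flatMap, dJ_S₂ h,
      dWeightedG_S₂, c₃_eq] <;> simp [S₂, X₁, dK] <;> ring

theorem dFlatMap_Y (h : ρ (m 0) ≠ 0) : dFlatMap P F ρ χ m (Y P F ρ χ m) =
    ![-flatMap P F ρ χ m 3, -flatMap P F ρ χ m 4, -1, 0, 0] := by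
  have he := Real.exp_ne_zero (-(1 / 3) * F (m 0))
  funext i
  fin_cases i <;> simp [dFlatMap, flatMap, dJ_Y, dWeightedG_Y h]
  · simp only [Y, X₁, X₃, weightY, Pi.sub_apply, Pi.smul_apply, smul_eq_mul, Matrix.cons_val]
    rw [exp_third]
    field_simp
    ring
  · rw [← neg_mul, exp_neg_two_thirds]
    simp only [Y, X₁, X₃, dK, J, B, coeffK₀, coeffK₁, coeffK₂, Pi.sub_apply, Pi.smul_apply,
      smul_eq_mul, Matrix.cons_val]
    rw [exp_third]
    field_simp
    ring
  · simp [Y, X₁, X₃]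
  · simp [Y, X₁, X₃]

/-- The model counterpart of `S₃_eq`, with (-a₄, -a₅, -1, 0, 0) in the role of Y. -/
theorem evalField_f₁₁₂ (a : Fin 5 → ℝ) :
    (1 / 2 : ℝ) • FlatCartan.evalField FlatCartan.f₁₁₂ a =
      -(3 / 8 * a 0 - 1 / 8 * a 2 * a 3 + 1 / 16 * a 3 ^ 2 * a 4) •
          FlatCartan.evalField FlatCartan.e₁ a
        + (12 * a 1 - 4 * a 2 * a 4 - 2 * a 3 * a 4 ^ 2) • FlatCartan.evalField FlatCartan.e₁₂ a
        + a 2 ^ 2 • ![-a 3, -a 4, -1, 0, 0] := by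
  funext i
  fin_cases i <;> simp [FlatCartan.evalField, FlatCartan.e₁, FlatCartan.e₁₂, FlatCartan.f₁₁₂,
    FlatCartan.polyField_X] <;> ring

end Relations

end Chazy

end

noncomputable section

/-! ### The flattening map is a local diffeomorphism -/

namespace Chazy

variable {P F ρ χ : ℝ → ℝ} {I : Opens ℝ} {m : Fin 5 → ℝ}

namespace CoeffSystem

variable (s : CoeffSystem P F ρ χ I)

include s

/-- Smoothness provides a Fréchet derivative, and uniqueness of derivatives along lines identifies
it with the explicit formula. -/
theorem fderiv_flatMap (hm : m 0 ∈ I) (v : Fin 5 → ℝ) :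
    fderiv ℝ (flatMap P F ρ χ) m v = dFlatMap P F ρ χ m v := by
  have h : HasFDerivAt (flatMap P F ρ χ) (fderiv ℝ (flatMap P F ρ χ) m) m :=
    ((s.smooth.contDiffAt_flatMap hm (s.ne _ hm)).differentiableAt (by simp)).hasFDerivAt
  exact HasDerivAt.unique (h.hasLineDerivAt v) (s.hasDerivAt_flatMap_line hm v)

/-- The differential is triangular. χ controls v₀, and w then controls v₁. The third coordinate
reduces to dG and gives v₃, J gives v₄, and only ½v₂ is left in the second coordinate. -/
theorem eq_zero_of_dFlatMap (hm : m 0 ∈ I) {v : Fin 5 → ℝ} (hv : dFlatMap P F ρ χ m v = 0) :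
    v = 0 := by
  have hρ := s.ne _ hm
  have he := Real.exp_ne_zero (-(1 / 3) * F (m 0))
  have h0 : v 0 = 0 := by
    have h := congrFun hv 3
    simp only [dFlatMap, Matrix.cons_val, Pi.zero_apply] at h
    exact (mul_eq_zero.mp h).resolve_left (by positivity)
  have h1 : v 1 = 0 := by
    have h := congrFun hv 0
    simp only [dFlatMap, Matrix.cons_val, Pi.zero_apply, h0, mul_zero, zero_mul, zero_add] at h
    exact (mul_eq_zero.mp h).resolve_left
      (neg_ne_zero.mpr (mul_ne_zero (one_div_ne_zero (pow_ne_zero 3 hρ)) he))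
  have hJ : dJ P F ρ m v = 0 := by simpa [dFlatMap] using congrFun hv 4
  have hG : dWeightedG P F ρ m v = 0 := by
    have h := congrFun hv 2
    simpa [dFlatMap, h0, hJ] using h
  have h3 : v 3 = 0 := by
    rw [dWeightedG, dG, h0, h1] at hG
    have h := (mul_eq_zero.mp hG).resolve_left (mul_ne_zero (one_div_ne_zero hρ) he)
    linarith
  have h4 : v 4 = 0 := by
    have h := hJ
    rw [dJ, dB, h0, h1, h3] at h
    have h := (mul_eq_zero.mp h).resolve_left
      (mul_ne_zero (mul_ne_zero (by norm_num) hρ) he)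
    linarith
  have h2 : v 2 = 0 := by
    have h := congrFun hv 1
    simpa [dFlatMap, dK, h0, h1, h3, hJ, hG] using h
  funext i
  fin_cases i <;> assumption

theorem exists_equiv_fderiv (hm : m 0 ∈ I) : ∃ L : (Fin 5 → ℝ) ≃L[ℝ] (Fin 5 → ℝ),
    (L : (Fin 5 → ℝ) →L[ℝ] (Fin 5 → ℝ)) = fderiv ℝ (flatMap P F ρ χ) m := by
  have hinj : Function.Injective (fderiv ℝ (flatMap P F ρ χ) m).toLinearMap := by
    rw [injective_iff_map_eq_zero]
    intro v hv
    exact s.eq_zero_of_dFlatMap hm ((s.fderiv_flatMap hm v).symm.trans hv)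
  refine ⟨(LinearEquiv.ofInjectiveEndo _ hinj).toContinuousLinearEquiv, ?_⟩
  ext v : 1
  rfl

theorem fderiv_flatMap_S₁ (hm : m 0 ∈ I) : fderiv ℝ (flatMap P F ρ χ) m (S₁ P F ρ m) =
    FlatCartan.evalField FlatCartan.e₁ (flatMap P F ρ χ m) :=
  (s.fderiv_flatMap hm _).trans (dFlatMap_S₁ (s.ne _ hm))

theorem fderiv_flatMap_S₂ (hm : m 0 ∈ I) : fderiv ℝ (flatMap P F ρ χ) m (S₂ F ρ m) =
    FlatCartan.evalField FlatCartan.e₁₂ (flatMap P F ρ χ m) :=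
  (s.fderiv_flatMap hm _).trans (dFlatMap_S₂ (s.ne _ hm))

theorem fderiv_flatMap_S₃ (hm : m 0 ∈ I) : fderiv ℝ (flatMap P F ρ χ) m (S₃ P F ρ χ m) =
    (1 / 2 : ℝ) • FlatCartan.evalField FlatCartan.f₁₁₂ (flatMap P F ρ χ m) := by
  have hρ := s.ne _ hm
  have hc : c₃ P F ρ χ m = flatMap P F ρ χ m 2 := rfl
  rw [S₃_eq hρ, map_add, map_add, map_smul, map_smul, map_smul, s.fderiv_flatMap_S₁ hm,
    s.fderiv_flatMap_S₂ hm, s.fderiv_flatMap hm, dFlatMap_Y hρ, evalField_f₁₁₂, c₁_eq P F ρ χ m hρ,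
    c₂_eq, hc]

end CoeffSystem

/-! ### The distributions -/

theorem mem_monge_iff {t : ℝ} {v : Fin 5 → ℝ} :
    v ∈ Distribution235.monge (fun x => Real.exp (t * F x)) m ↔
      v 1 = m 3 * v 0 ∧ v 3 = m 4 * v 0 ∧ v 2 = m 4 ^ 2 * Real.exp (-t * F (m 0)) * v 0 := by
  simp [Distribution235.monge, Distribution235.coordForm, sub_eq_zero, and_assoc, Real.exp_neg,
    div_eq_mul_inv]

theorem span_X_eq_monge (m : Fin 5 → ℝ) : Submodule.span ℝ {X₁ m, X₂ F m} =
    Distribution235.monge (fun x => Real.exp (2 / 3 * F x)) m := by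
  ext v
  rw [Submodule.mem_span_pair, mem_monge_iff]
  constructor
  · rintro ⟨a, b, rfl⟩
    simp [X₁, X₂, mul_comm]
  · rintro ⟨h1, h3, h2⟩
    refine ⟨v 4, v 0, ?_⟩
    funext i
    fin_cases i <;> simp [X₁, X₂, h1, h2, h3, mul_comm]

theorem span_S_eq_span_X (h : ρ (m 0) ≠ 0) : Submodule.span ℝ {S₁ P F ρ m, S₂ F ρ m} =
    Submodule.span ℝ {X₁ m, X₂ F m} := by
  have he := Real.exp_ne_zero (1 / 3 * F (m 0))
  apply le_antisymm <;> rw [Submodule.span_le, pair_subset_iff]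
  · exact ⟨Submodule.sub_mem _ (Submodule.smul_mem _ _ (Submodule.subset_span (by simp)))
      (Submodule.smul_mem _ _ (Submodule.subset_span (by simp))),
      Submodule.smul_mem _ _ (Submodule.subset_span (by simp))⟩
  · simp only [SetLike.mem_coe, Submodule.mem_span_pair]
    refine ⟨⟨0, 4 * ρ (m 0) / Real.exp (1 / 3 * F (m 0)), ?_⟩,
      ⟨-(1 / (8 * ρ (m 0) ^ 2)), -(T P ρ m * ρ (m 0) / (2 * Real.exp (1 / 3 * F (m 0)))), ?_⟩⟩
    · rw [S₂, smul_smul, zero_smul, zero_add]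
      field_simp
      rw [one_smul]
    · rw [S₁, S₂]
      match_scalars
      · field_simp
        ring
      · field_simp

/-- The two fields frame the distribution without being symmetries of it: [e₁, e₁₂] = 2∂_{a₃} is not
annihilated by the third form. The coefficients are read off from v₃ and v₄, since e₁ has ∂_{a₄}
component -8 and e₁₂ has ∂_{a₅} component 1/4. -/
theorem span_evalField_eq_flatCartan (a : Fin 5 → ℝ) :
    Submodule.span ℝ {FlatCartan.evalField FlatCartan.e₁ a, FlatCartan.evalField FlatCartan.e₁₂ a} =
      Distribution235.flatCartan a := by
  ext v
  rw [Submodule.mem_span_pair]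
  simp only [Distribution235.flatCartan, Distribution235.coordForm, Submodule.mem_inf,
    LinearMap.mem_ker, LinearMap.add_apply, LinearMap.sub_apply, LinearMap.smul_apply,
    LinearMap.proj_apply, smul_eq_mul]
  constructor
  · rintro ⟨b, c, rfl⟩
    simp [FlatCartan.evalField, FlatCartan.e₁, FlatCartan.e₁₂, FlatCartan.polyField_X]
    refine ⟨⟨?_, ?_⟩, ?_⟩ <;> ring
  · rintro ⟨⟨h0, h1⟩, h2⟩
    refine ⟨-(1 / 8) * v 3, 4 * v 4, ?_⟩
    funext i
    fin_cases i <;>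
      simp [FlatCartan.evalField, FlatCartan.e₁, FlatCartan.e₁₂, FlatCartan.polyField_X] <;>
      linarith

theorem CoeffSystem.isLocallyFlatOn (s : CoeffSystem P F ρ χ I) :
    Distribution235.IsLocallyFlatOn
      (Distribution235.monge (fun x => Real.exp (2 / 3 * F x))) (domain I) := by
  intro m hm
  have hsm (m') (hm' : m' ∈ domain I) : ContDiffAt ℝ ∞ (flatMap P F ρ χ) m' :=
    s.smooth.contDiffAt_flatMap hm' (s.ne _ hm')
  obtain ⟨L, hL⟩ := s.exists_equiv_fderiv hm
  have hs : HasStrictFDerivAt (flatMap P F ρ χ) (L : (Fin 5 → ℝ) →L[ℝ] (Fin 5 → ℝ)) m := by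
    rw [hL]
    exact (hsm m hm).hasStrictFDerivAt (by simp)
  refine ⟨(hs.toOpenPartialHomeomorph _).restrOpen (domain I) (domain I).isOpen, ?_, ?_, ?_, ?_, ?_⟩
  · exact ⟨hs.mem_toOpenPartialHomeomorph_source, hm⟩
  · exact fun x hx => hx.2
  · exact fun x hx => (hsm x hx.2).contDiffWithinAt
  · intro a ha
    set e := (hs.toOpenPartialHomeomorph _).restrOpen (domain I) (domain I).isOpen
    have hx : e.symm a ∈ domain I := (e.map_target ha).2
    obtain ⟨L', hL'⟩ := s.exists_equiv_fderiv hx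
    refine (e.contDiffAt_symm (f₀' := L') ha ?_ (hsm _ hx)).contDiffWithinAt
    rw [hL']
    exact ((hsm _ hx).differentiableAt (by simp)).hasFDerivAt
  · intro x hx
    have hx' : x 0 ∈ I := hx.2
    change Submodule.map (fderiv ℝ (flatMap P F ρ χ) x).toLinearMap _ =
      Distribution235.flatCartan (flatMap P F ρ χ x)
    rw [← span_X_eq_monge, ← span_S_eq_span_X (P := P) (s.ne _ hx'), Submodule.map_span, image_pair,
      ← span_evalField_eq_flatCartan, ← s.fderiv_flatMap_S₁ hx', ← s.fderiv_flatMap_S₂ hx']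
    rfl

end Chazy

end

theorem theorem4p1 (I : TopologicalSpace.Opens ℝ) (hI : (I : Set ℝ).Nonempty)
    (P F ρ χ : ℝ → ℝ)
    (hP : Chazy.IsSolution (3 / 2) P I)
    (hF : ∀ x ∈ I, HasDerivAt F (P x) x)
    (hρ : ContDiffOn ℝ 2 ρ I)
    (hρ_ne : ∀ x ∈ I, ρ x ≠ 0)
    (hρ_eq : ∀ x ∈ I, iteratedDeriv 2 ρ x - 1 / 45 * Chazy.Q P x * ρ x = 0)
    (hχ : ∀ x ∈ I, HasDerivAt χ (1 / (ρ x) ^ 2) x) :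
    (∀ m ∈ Chazy.domain I,
      Submodule.span ℝ {Chazy.X₁ m, Chazy.X₂ F m} =
        Distribution235.monge (fun x => Real.exp (2 / 3 * F x)) m) ∧
    (∀ m ∈ Chazy.domain I,
      Submodule.span ℝ {Chazy.S₁ P F ρ m, Chazy.S₂ F ρ m} =
        Distribution235.monge (fun x => Real.exp (2 / 3 * F x)) m) ∧
    Distribution235.IsLocallyFlatOn
      (Distribution235.monge (fun x => Real.exp (2 / 3 * F x))) (Chazy.domain I) ∧
    ∃ (h₁ : ContDiffOn ℝ ∞ (Chazy.S₁ P F ρ) (Chazy.domain I))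
      (h₂ : ContDiffOn ℝ ∞ (Chazy.S₂ F ρ) (Chazy.domain I))
      (h₃ : ContDiffOn ℝ ∞ (Chazy.S₃ P F ρ χ) (Chazy.domain I)),
      BracketG2.PairwiseGenerates
        (SmoothField.ofContDiffOn (Chazy.S₁ P F ρ) h₁)
        (SmoothField.ofContDiffOn (Chazy.S₂ F ρ) h₂)
        (SmoothField.ofContDiffOn (Chazy.S₃ P F ρ χ) h₃) := by
  have s := Chazy.coeffSystem hP hF hρ hρ_ne hρ_eq hχ
  refine ⟨fun m _ => Chazy.span_X_eq_monge m,
    fun m hm => (Chazy.span_S_eq_span_X (hρ_ne _ hm)).trans (Chazy.span_X_eq_monge m),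
    s.isLocallyFlatOn,
    fun m hm => (s.smooth.contDiffAt_S₁ hm).contDiffWithinAt,
    fun m hm => (s.smooth.contDiffAt_S₂ hm (hρ_ne _ hm)).contDiffWithinAt,
    fun m hm => (s.smooth.contDiffAt_S₃ hm (hρ_ne _ hm)).contDiffWithinAt, ?_⟩
  -- A point of U is needed for injectivity of the pullback. The point with all coordinates x will
  -- do, since only the first coordinate is constrained.
  obtain ⟨x, hx⟩ := hI
  exact FlatCartan.pairwiseGenerates_of_related
    (fun m hm => (s.smooth.contDiffAt_flatMap hm (hρ_ne _ hm)).contDiffWithinAt)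
    (fun m hm => s.exists_equiv_fderiv hm) ⟨fun _ => x, hx⟩ _ _ _
    (fun m hm => s.fderiv_flatMap_S₁ hm) (fun m hm => s.fderiv_flatMap_S₂ hm)
    (fun m hm => s.fderiv_flatMap_S₃ hm)
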